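/- Consider a finite Markov decision process with nonempty finite state space $\mathcal S$, nonempty finite action space $\mathcal A$, transition matrices $P_a$ ($a\in\mathcal A$), rewards $\mathcal R:\mathcal S\times\mathcal A\to[0,1]$ and discount factor $\gamma\in(0,1)$. Let $\pi_b$ be a behavior policy with $\pi_b(a|s)>0$ for all $(s,a)$ such that the induced Markov chain on $\mathcal S$, with transition matrix $P(s,s')=\sum_a\pi_b(a|s)P_a(s,s')$, is irreducible and aperiodic, with stationary distribution $\kappa_S$. Let $n\ge 1$, and let $c,\rho:\mathcal S\times\mathcal A\to[0,\infty)$ satisfy $c(s,a)\le\rho(s,a)$ for all $(s,a)$. Put $D_c(s)=\sum_a\pi_b(a|s)c(s,a)$, $D_\rho(s)=\sum_a\pi_b(a|s)\rho(s,a)$, and denote minima and maxima over all arguments by the subscripts $\min$ and $\max$. Suppose $D_{\rho,\max}<1/\gamma$. Let $f(x)=\sum_{i=0}^{n-1}x^i$ and $$\omega=\Big(\min_{s,a}\kappa_S(s)\pi_b(a|s)\Big)\,f(\gamma D_{c,\min})\,(1-\gamma D_{\rho,\max}).$$ Let $Q^{\pi,\rho}$ be the fixed point of the operator $[\mathcal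 H_\rho(Q)](s,a)=\mathcal R(s,a)+\gamma\sum_{s'}P_a(s,s')\sum_{a'}\pi_b(a'|s')\rho(s',a')Q(s',a')$. For $\delta>0$ let $t_\delta=\min\{k\ge 0:\max_s\|P^k(s,\cdot)-\kappa_S\|_{TV}\le\delta\}$ and $\tau_{\delta,n}=t_\delta+n+1$. Let $\{(S_k,A_k)\}_{k\ge0}$ be a trajectory of the process under $\pi_b$ (with any law of $S_0$). For a constant stepsize $\alpha>0$ and $Q_0\in\mathbb R^{|\mathcal S||\mathcal A|}$ let $$Q_{k+1}(s,a)=Q_k(s,a)+\alpha\,\mathbb I_{\{(s,a)=(S_k,A_k)\}}\sum_{i=k}^{k+n-1}\gamma^{i-k}\prod_{j=k+1}^{i}c(S_j,A_j)\big(\mathcal R(S_i,A_i)+\gamma\rho(S_{i+1},A_{i+1})Q_k(S_{i+1},A_{i+1})-Q_k(S_i,A_i)\big).$$ Then for every $\theta\in(0,1)$ there is a probability vector $\mu$ on $\mathcal S\times\mathcal A$ with positive entries and $$\mu_{\min}\ge\frac{\omega(1-\theta)}{(1-\theta\omega)|\mathcal S||\mathcal A|}$$ such that the following holds for every $p\in[2,\infty)$,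 with $\|x\|_{\mu,p}=\big(\sum_{s,a}\mu(s,a)|x(s,a)|^p\big)^{1/p}$. If the stepsize satisfies $$\alpha\,\tau_{\alpha,n}\le\frac{\theta\,\mu_{\min}^{2/p}\,\omega}{2052\,p\,f(\gamma c_{\max})^2(\gamma\rho_{\max}+1)^2},$$ then for all $k\ge\tau_{\alpha,n}$ (and every $Q_0$) $$\mathbb E\big[\|Q_k-Q^{\pi,\rho}\|_{\mu,p}^2\big]\le\tilde\zeta_1(1-\theta\omega\alpha)^{k-\tau_{\alpha,n}}+\tilde\zeta_2\,\frac{p\,f(\gamma c_{\max})^2(\gamma\rho_{\max}+1)^2}{\mu_{\min}^{2/p}\,\omega}\,\alpha\,\tau_{\alpha,n},$$ where $\tilde\zeta_1=(\|Q_0-Q^{\pi,\rho}\|_{\mu,p}+\|Q_0\|_{\mu,p}+1)^2$ and $\tilde\zeta_2=228\,(3\|Q^{\pi,\rho}\|_{\mu,p}+1)^2$. -/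

import Mathlib

namespace OffPolicyTD

/-- A finite Markov decision process with state space `S` and action space `A`: transition matrices
`trans a`, reward function with values in `[0,1]`, and discount factor `disc` (i.e. `γ`) in `(0,1)`. -/
structure MDP (S A : Type*) [Fintype S] where
  trans : A → Matrix S S ℝ
  trans_nonneg : ∀ a s s', 0 ≤ trans a s s'
  trans_sum : ∀ a s, ∑ s', trans a s s' = 1
  reward : S × A → ℝ
  reward_nonneg : ∀ x, 0 ≤ reward x
  reward_le_one : ∀ x, reward x ≤ 1
  disc : ℝ
  disc_pos : 0 < disc
  disc_lt_one : disc < 1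

/-- A (stationary, randomized) policy; `prob s a` is the probability of action `a` in state `s`. -/
structure Policy (S A : Type*) [Fintype A] where
  prob : S → A → ℝ
  prob_nonneg : ∀ s a, 0 ≤ prob s a
  prob_sum : ∀ s, ∑ a, prob s a = 1

/-- Irreducibility of the Markov chain with transition matrix `P`. -/
def IrreducibleChain {S : Type*} [Fintype S] [DecidableEq S] (P : Matrix S S ℝ) : Prop :=
  ∀ s s', ∃ k : ℕ, 0 < (P ^ k) s s'

/-- Aperiodicity: for every state, the greatest common divisor of the possible return times
is one. -/
def AperiodicChain {S : Type*} [Fintype S] [DecidableEq S] (P : Matrix S S ℝ) : Prop :=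
  ∀ s, ∀ d : ℕ, (∀ k : ℕ, 1 ≤ k → 0 < (P ^ k) s s → d ∣ k) → d = 1

/-- `κ` is a stationary distribution of the Markov chain with transition matrix `P`. -/
def IsStationaryDist {S : Type*} [Fintype S] (P : Matrix S S ℝ) (κ : S → ℝ) : Prop :=
  (∀ s, 0 ≤ κ s) ∧ ∑ s, κ s = 1 ∧ ∀ s', ∑ s, κ s * P s s' = κ s'

/-- The stationary distribution of the chain (it exists and is unique for an irreducible chain;
if there is none, the value is arbitrary). -/
noncomputable def stationaryDist {S : Type*} [Fintype S] (P : Matrix S S ℝ) : S → ℝ :=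
  Classical.epsilon (IsStationaryDist P)

/-- Total variation distance of two probability vectors on a finite set. -/
noncomputable def tvDist {S : Type*} [Fintype S] (p q : S → ℝ) : ℝ :=
  (1 / 2) * ∑ s, |p s - q s|

/-- The mixing time with precision `δ`: the least `k` such that `P ^ k` started in any state is
within `δ` of the stationary distribution in total variation. -/
noncomputable def mixingTime {S : Type*} [Fintype S] [DecidableEq S]
    (P : Matrix S S ℝ) (δ : ℝ) : ℕ :=
  sInf {k : ℕ | ∀ s, tvDist (fun s' => (P ^ k) s s') (stationaryDist P) ≤ δ}

/-- The function `f` with `f x = 1 + x + ... + x ^ (n - 1)`. -/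
noncomputable def geomF (n : ℕ) (x : ℝ) : ℝ :=
  if x = 1 then (n : ℝ) else (1 - x ^ n) / (1 - x)

/-- The weighted `ℓ_p`-norm with weights `μ`. -/
noncomputable def wNorm {X : Type*} [Fintype X] (μ : X → ℝ) (p : ℝ) (Q : X → ℝ) : ℝ :=
  (∑ x, μ x * |Q x| ^ p) ^ (1 / p)

section TD

variable {S A : Type*} [Fintype S] [Fintype A]

/-- Transition matrix of the state chain induced by the policy `πb`. -/
def stateChain (M : MDP S A) (πb : Policy S A) : Matrix S S ℝ :=
  Matrix.of fun s s' => ∑ a, πb.prob s a * M.trans a s s'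

/-- Stationary distribution of the state-action chain, `κ_S(s) π_b(a | s)`. -/
noncomputable def stationarySA (M : MDP S A) (πb : Policy S A) (x : S × A) : ℝ :=
  stationaryDist (stateChain M πb) x.1 * πb.prob x.1 x.2

/-- The diagonal entries `D_c(s) = ∑_a π_b(a | s) c(s, a)`. -/
def diagD (πb : Policy S A) (c : S × A → ℝ) (s : S) : ℝ :=
  ∑ a, πb.prob s a * c (s, a)

/-- The contraction parameter `ω = K_{SA,min} f(γ D_{c,min}) (1 - γ D_{ρ,max})`. -/
noncomputable def omega (M : MDP S A) (πb : Policy S A) (n : ℕ) (c ρ : S × A → ℝ) : ℝ :=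
  (⨅ x, stationarySA M πb x) * geomF n (M.disc * ⨅ s, diagD πb c s) *
    (1 - M.disc * ⨆ s, diagD πb ρ s)

/-- The operator `H_ρ`:
`H_ρ(Q)(s,a) = R(s,a) + γ E_{π_b}[ρ(S_1,A_1) Q(S_1,A_1) | S_0 = s, A_0 = a]`. -/
def opH (M : MDP S A) (πb : Policy S A) (ρ : S × A → ℝ) (Q : S × A → ℝ) : S × A → ℝ :=
  fun x => M.reward x + M.disc *
    ∑ s', M.trans x.2 x.1 s' * ∑ a', πb.prob s' a' * (ρ (s', a') * Q (s', a'))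

/-- The limit point `Q^{π,ρ}`: the fixed point of `H_ρ` (it exists and is unique when
`D_{ρ,max} < 1 / γ`; if there is none, the value is arbitrary). -/
noncomputable def limitQ (M : MDP S A) (πb : Policy S A) (ρ : S × A → ℝ) : S × A → ℝ :=
  Classical.epsilon fun Q => opH M πb ρ Q = Q

/-- Temporal difference `R(x) + γ ρ(y) Q(y) - Q(x)` for consecutive state-action pairs `x, y`. -/
def tdError (M : MDP S A) (ρ Q : S × A → ℝ) (x y : S × A) : ℝ :=
  M.reward x + M.disc * ρ y * Q y - Q x

/-- The iterates of the generic `n`-step off-policy TD algorithm with constant stepsize `α`,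
initialization `Q₀`, and generalized importance sampling ratios `c, ρ`, run along the
state-action sequence `z`. -/
def tdIterate [DecidableEq S] [DecidableEq A] (M : MDP S A) (n : ℕ) (c ρ : S × A → ℝ) (α : ℝ)
    (Q₀ : S × A → ℝ) (z : ℕ → S × A) : ℕ → S × A → ℝ
  | 0 => Q₀
  | k + 1 => fun x =>
      tdIterate M n c ρ α Q₀ z k x + (if x = z k then α else 0) *
        ∑ i ∈ Finset.Ico k (k + n), M.disc ^ (i - k) * (∏ j ∈ Finset.Icc (k + 1) i, c (z j)) *
          tdError M ρ (tdIterate M n c ρ α Q₀ z k) (z i) (z (i + 1))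

/-- The process `Z k = (S_k, A_k)` is a trajectory of the MDP collected under the policy `πb`, with
arbitrary law of the initial state: the probability of any finite path is the probability of its
initial state times the product of the policy and transition probabilities along the path. -/
def IsTrajectory (M : MDP S A) (πb : Policy S A) {Ω : Type*} [MeasurableSpace Ω]
    (Pr : MeasureTheory.Measure Ω) (Z : ℕ → Ω → S × A) : Prop :=
  (∀ k x, MeasurableSet {w | Z k w = x}) ∧
  ∀ (m : ℕ) (z : ℕ → S × A),
    Pr.real {w | ∀ i ≤ m, Z i w = z i} =
      Pr.real {w | (Z 0 w).1 = (z 0).1} * πb.prob (z 0).1 (z 0).2 *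
        ∏ i ∈ Finset.range m, M.trans (z i).2 (z i).1 (z (i + 1)).1 *
          πb.prob (z (i + 1)).1 (z (i + 1)).2

/-- The delay `τ_{α,n} = t_α + n + 1`, where `t_α` is the mixing time of the state chain. -/
noncomputable def delay [DecidableEq S] (M : MDP S A) (πb : Policy S A) (n : ℕ) (α : ℝ) : ℕ :=
  mixingTime (stateChain M πb) α + n + 1

/-- `f(γ c_max)² (γ ρ_max + 1)²`. -/
noncomputable def varFactor (M : MDP S A) (n : ℕ) (c ρ : S × A → ℝ) : ℝ :=
  geomF n (M.disc * ⨆ x, c x) ^ 2 * (M.disc * (⨆ x, ρ x) + 1) ^ 2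

end TD

end OffPolicyTD

/-! The algorithm is stochastic approximation with Markovian noise, and half the squared weighted
`ℓ_p` norm serves directly as Lyapunov function. Write `G` for `bellmanMatrix` and `Q'` for
`limitQ`. As the mean temporal difference vanishes at `Q'`, the stationary mean increment is `(G -
1)(q - Q')` (`meanInc_eq`).

Three facts about `G` drive the contraction. Its entries are nonnegative because `c ≤ ρ`
(`bellmanMatrix_nonneg`), its row sums are at most `1 - ω` (`bellmanMatrix_row_sum_le`), and a
resolvent of `G` yields a positive probability vector `μ` with `μ G ≤ (1 - θω) μ` (`exists_weight`).
Young's inequality combines the row bound, with weight `1 - 1/p`, and the column bound, with weight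
`1/p`. For every `p ≥ 2` at once, the mean increment therefore has inner product at most `-(1 + θ)/2
· ω ‖q - Q'‖²` with the gradient at `q - Q'` (`wGrad_pair_mulVec_le`). This is why `μ` depends on
`θ` but not on `p`.

The squared norm is smooth with a constant linear in `p` (`wNorm_add_sq_le`), so a step contributes
this drift, a quadratic term and a noise term. To bound the noise, gradient and iterate are frozen
at an earlier time. Conditioning on the past then leaves the difference between the law of the chain
after its mixing time and the stationary law (`IsTrajectory.integral_noise_le`). Freezing costs
little because the iterates move slowly over the window (`wNorm_sub_le_of_increments`).

The outcome is a scalar recursion with contraction `(1 + θ)ωα`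
(`IsTrajectory.integral_wNorm_sq_succ_le`). The stepsize condition lets the noise consume at most
`θωα` of it, and the remaining `ωα` gives the geometric bound (`mean_square_recursion_le`), started
from a crude pathwise bound at the end of the initial delay. -/

namespace OffPolicyTD

/-! ### Hölder's inequality and smoothness of the squared weighted `ℓ_p` norm. -/

section WeightedNorm

variable {X : Type*} [Fintype X]

/-- The gradient of `x ↦ ‖x‖² / 2` for the weighted `ℓ_p`-norm. -/
noncomputable def wGrad (μ : X → ℝ) (p : ℝ) (x : X → ℝ) : X → ℝ :=
  fun i => wNorm μ p x ^ (2 - p) * (μ i * (|x i| ^ (p - 2) * x i))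

theorem wNorm_nonneg {μ : X → ℝ} (hμ : ∀ i, 0 < μ i) (p : ℝ) (x : X → ℝ) : 0 ≤ wNorm μ p x :=
  Real.rpow_nonneg (Finset.sum_nonneg fun i _ =>
    mul_nonneg (hμ i).le (Real.rpow_nonneg (abs_nonneg _) _)) _

theorem wNorm_rpow {μ : X → ℝ} (hμ : ∀ i, 0 < μ i) {p : ℝ} (hp : 2 ≤ p) (x : X → ℝ) :
    wNorm μ p x ^ p = ∑ i, μ i * |x i| ^ p := by
  unfold wNorm
  rw [← Real.rpow_mul (Finset.sum_nonneg fun i _ =>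
    mul_nonneg (hμ i).le (Real.rpow_nonneg (abs_nonneg _) _)), one_div_mul_cancel (by linarith),
    Real.rpow_one]

theorem eq_zero_of_wNorm_eq_zero {μ : X → ℝ} (hμ : ∀ i, 0 < μ i) {p : ℝ} (hp : 2 ≤ p)
    {x : X → ℝ} (h : wNorm μ p x = 0) (i : X) : x i = 0 := by
  have h1 := wNorm_rpow hμ hp x
  rw [h, Real.zero_rpow (by linarith), eq_comm, Finset.sum_eq_zero_iff_of_nonneg fun i _ =>
    mul_nonneg (hμ i).le (Real.rpow_nonneg (abs_nonneg _) _)] at h1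
  have h2 := h1 i (Finset.mem_univ i)
  rcases mul_eq_zero.1 h2 with h3 | h3
  · exact absurd h3 (hμ i).ne'
  · exact abs_eq_zero.1 ((Real.rpow_eq_zero (abs_nonneg _) (by linarith)).1 h3)

theorem wNorm_zero (μ : X → ℝ) {p : ℝ} (hp : 2 ≤ p) : wNorm μ p 0 = 0 := by
  simp [wNorm, Real.zero_rpow (show p ≠ 0 by linarith), Real.zero_rpow (show p⁻¹ ≠ 0 by positivity)]

theorem wNorm_neg (μ : X → ℝ) (p : ℝ) (x : X → ℝ) : wNorm μ p (-x) = wNorm μ p x := by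
  simp [wNorm]

theorem wNorm_sub_comm (μ : X → ℝ) (p : ℝ) (x y : X → ℝ) :
    wNorm μ p (x - y) = wNorm μ p (y - x) := by
  rw [← wNorm_neg, neg_sub]

theorem wNorm_le_of_abs_le {μ : X → ℝ} (hμ : ∀ i, 0 < μ i) (hμ1 : ∑ i, μ i = 1) {p : ℝ}
    (hp : 2 ≤ p) {x : X → ℝ} {r : ℝ} (hr : 0 ≤ r) (h : ∀ i, |x i| ≤ r) : wNorm μ p x ≤ r := by
  have h1 : ∑ i, μ i * |x i| ^ p ≤ r ^ p := by
    calc ∑ i, μ i * |x i| ^ p ≤ ∑ i, μ i * r ^ p := by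
          refine Finset.sum_le_sum fun i _ => mul_le_mul_of_nonneg_left ?_ (hμ i).le
          exact Real.rpow_le_rpow (abs_nonneg _) (h i) (by linarith)
      _ = r ^ p := by rw [← Finset.sum_mul, hμ1, one_mul]
  rw [← wNorm_rpow hμ hp] at h1
  exact (Real.rpow_le_rpow_iff (wNorm_nonneg hμ _ _) hr (by linarith)).1 h1

theorem rpow_mul_abs_le_wNorm {μ : X → ℝ} (hμ : ∀ i, 0 < μ i) {p : ℝ}
    (hp : 2 ≤ p) (x : X → ℝ) (i : X) : μ i ^ (1 / p) * |x i| ≤ wNorm μ p x := by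
  have hp0 : 0 < p := by linarith
  rw [← Real.rpow_le_rpow_iff (mul_nonneg (Real.rpow_nonneg (hμ i).le _) (abs_nonneg _))
    (wNorm_nonneg hμ _ _) hp0, wNorm_rpow hμ hp,
    Real.mul_rpow (Real.rpow_nonneg (hμ i).le _) (abs_nonneg _), ← Real.rpow_mul (hμ i).le,
    one_div_mul_cancel hp0.ne', Real.rpow_one]
  exact Finset.single_le_sum (f := fun i => μ i * |x i| ^ p)
    (fun i _ => mul_nonneg (hμ i).le (Real.rpow_nonneg (abs_nonneg _) _)) (Finset.mem_univ i)

/-- Weighted AM-GM with weights `(p-2)/p`, `1/p`, `1/p`, applied to the `p`-th powers. -/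
theorem rpow_mul_mul_le_weighted {p : ℝ} (hp : 2 ≤ p) {a d h : ℝ} (ha : 0 ≤ a) (hd : 0 ≤ d)
    (hh : 0 ≤ h) :
    a ^ (p - 2) * d * h ≤ (p - 2) / p * a ^ p + 1 / p * d ^ p + 1 / p * h ^ p := by
  have hp0 : 0 < p := by linarith
  have h1 := Real.geom_mean_le_arith_mean3_weighted (w₁ := (p - 2) / p) (w₂ := 1 / p)
    (w₃ := 1 / p) (p₁ := a ^ p) (p₂ := d ^ p) (p₃ := h ^ p) (div_nonneg (by linarith) hp0.le)
    (by positivity) (by positivity) (by positivity) (by positivity) (by positivity)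
    (by field_simp; ring)
  rwa [← Real.rpow_mul ha, ← Real.rpow_mul hd, ← Real.rpow_mul hh, mul_div_cancel₀ _ hp0.ne',
    mul_one_div_cancel hp0.ne', Real.rpow_one, Real.rpow_one] at h1

/-- Hölder with exponents `p/(p-2)`, `p`, `p`: normalize the three functions, apply AM-GM in each
coordinate, and sum; the three weights add up to one. -/
theorem trilinear_le_of_pos {μ : X → ℝ} (hμ : ∀ i, 0 < μ i) {p : ℝ} (hp : 2 ≤ p)
    (a d h : X → ℝ) (ha : 0 < wNorm μ p a) (hd : 0 < wNorm μ p d) (hh : 0 < wNorm μ p h) :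
    ∑ i, μ i * (|a i| ^ (p - 2) * |d i| * |h i|) ≤
      wNorm μ p a ^ (p - 2) * wNorm μ p d * wNorm μ p h := by
  have hp0 : 0 < p := by linarith
  set N := wNorm μ p
  have key : ∀ i, μ i * (|a i| ^ (p - 2) * |d i| * |h i|) ≤
      (N a ^ (p - 2) * N d * N h) * ((p - 2) / p * (μ i * |a i| ^ p / N a ^ p) +
        1 / p * (μ i * |d i| ^ p / N d ^ p) + 1 / p * (μ i * |h i| ^ p / N h ^ p)) := by
    intro i
    have h1 := rpow_mul_mul_le_weighted hp (div_nonneg (abs_nonneg (a i)) ha.le)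
      (div_nonneg (abs_nonneg (d i)) hd.le) (div_nonneg (abs_nonneg (h i)) hh.le)
    rw [Real.div_rpow (abs_nonneg _) ha.le, Real.div_rpow (abs_nonneg _) ha.le,
      Real.div_rpow (abs_nonneg _) hd.le, Real.div_rpow (abs_nonneg _) hh.le] at h1
    have hA : 0 < N a ^ (p - 2) := Real.rpow_pos_of_pos ha _
    have h2 := mul_le_mul_of_nonneg_left h1
      (mul_nonneg (mul_nonneg (mul_nonneg hA.le hd.le) hh.le) (hμ i).le)
    calc μ i * (|a i| ^ (p - 2) * |d i| * |h i|)
        = N a ^ (p - 2) * N d * N h * μ i *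
          (|a i| ^ (p - 2) / N a ^ (p - 2) * (|d i| / N d) * (|h i| / N h)) := by
            field_simp
      _ ≤ _ := h2
      _ = _ := by ring
  refine (Finset.sum_le_sum fun i _ => key i).trans (le_of_eq ?_)
  rw [← Finset.mul_sum, Finset.sum_add_distrib, Finset.sum_add_distrib, ← Finset.mul_sum,
    ← Finset.mul_sum, ← Finset.mul_sum, ← Finset.sum_div, ← Finset.sum_div, ← Finset.sum_div,
    ← wNorm_rpow hμ hp, ← wNorm_rpow hμ hp, ← wNorm_rpow hμ hp,
    div_self (Real.rpow_pos_of_pos ha _).ne', div_self (Real.rpow_pos_of_pos hd _).ne',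
    div_self (Real.rpow_pos_of_pos hh _).ne']
  field_simp
  ring

theorem trilinear_le {μ : X → ℝ} (hμ : ∀ i, 0 < μ i) {p : ℝ} (hp : 2 ≤ p) (a d h : X → ℝ) :
    ∑ i, μ i * (|a i| ^ (p - 2) * |d i| * |h i|) ≤
      wNorm μ p a ^ (p - 2) * wNorm μ p d * wNorm μ p h := by
  have hN := wNorm_nonneg hμ p
  rcases (hN h).eq_or_lt with hh | hh
  · simp [← hh, eq_zero_of_wNorm_eq_zero hμ hp hh.symm]
  rcases (hN d).eq_or_lt with hd | hd
  · simp [← hd, eq_zero_of_wNorm_eq_zero hμ hp hd.symm]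
  rcases (hN a).eq_or_lt with ha | ha
  · rcases hp.eq_or_lt with h2 | h2
    -- For `p = 2` the factor `|a i| ^ 0` is `1` even where `a` vanishes, so the bound is
    -- nontrivial. Any function of positive norm, here `d`, can replace `a`.
    · subst h2
      simpa using trilinear_le_of_pos hμ le_rfl d d h hd hd hh
    · have h3 : p - 2 ≠ 0 := by linarith
      simp [← ha, eq_zero_of_wNorm_eq_zero hμ hp ha.symm, Real.zero_rpow h3]
  · exact trilinear_le_of_pos hμ hp a d h ha hd hh

theorem rpow_sub_two_mul {p u : ℝ} (hp : 2 ≤ p) (hu : 0 ≤ u) : u ^ (p - 2) * u * u = u ^ p := by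
  rcases hu.eq_or_lt with h | h
  · subst h
    simp [Real.zero_rpow (show p ≠ 0 by linarith)]
  · rw [mul_assoc, ← pow_two, ← Real.rpow_natCast u 2, ← Real.rpow_add h]
    congr 1
    push_cast
    ring

theorem abs_wGrad_pair_le {μ : X → ℝ} (hμ : ∀ i, 0 < μ i) {p : ℝ} (hp : 2 ≤ p) (x h : X → ℝ) :
    |∑ i, wGrad μ p x i * h i| ≤ wNorm μ p x * wNorm μ p h := by
  have hN := wNorm_nonneg hμ p
  have h1 : |∑ i, wGrad μ p x i * h i| ≤
      wNorm μ p x ^ (2 - p) * ∑ i, μ i * (|x i| ^ (p - 2) * |x i| * |h i|) := by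
    rw [Finset.mul_sum]
    refine (Finset.abs_sum_le_sum_abs _ _).trans (le_of_eq (Finset.sum_congr rfl fun i _ => ?_))
    unfold wGrad
    rw [abs_mul, abs_mul, abs_mul, abs_mul, abs_of_nonneg (Real.rpow_nonneg (hN x) _),
      abs_of_pos (hμ i), abs_of_nonneg (Real.rpow_nonneg (abs_nonneg (x i)) _)]
    ring
  rcases (hN x).eq_or_lt with hx | hx
  -- At the origin the prefactor `0 ^ (2 - p)` is only a convention; all coordinates of `x` vanish,
  -- hence so does the gradient.
  · simp [wGrad, ← hx, eq_zero_of_wNorm_eq_zero hμ hp hx.symm]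
  · refine h1.trans ((mul_le_mul_of_nonneg_left (trilinear_le hμ hp x x h)
      (Real.rpow_nonneg (hN x) _)).trans (le_of_eq ?_))
    rw [← mul_assoc, ← mul_assoc, ← Real.rpow_add hx]
    simp

theorem wGrad_pair_self {μ : X → ℝ} (hμ : ∀ i, 0 < μ i) {p : ℝ} (hp : 2 ≤ p) (x : X → ℝ) :
    ∑ i, wGrad μ p x i * x i = wNorm μ p x ^ 2 := by
  rcases (wNorm_nonneg hμ p x).eq_or_lt with hx | hx
  · simp [wGrad, ← hx, eq_zero_of_wNorm_eq_zero hμ hp hx.symm]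
  · have h1 : ∑ i, wGrad μ p x i * x i = wNorm μ p x ^ (2 - p) * wNorm μ p x ^ p := by
      rw [wNorm_rpow hμ hp, Finset.mul_sum]
      refine Finset.sum_congr rfl fun i _ => ?_
      rw [← rpow_sub_two_mul hp (abs_nonneg (x i)), mul_assoc _ |x i| |x i|, abs_mul_abs_self]
      unfold wGrad
      ring
    rw [h1, ← Real.rpow_add hx, ← Real.rpow_natCast]
    congr 1
    push_cast
    ring

/-- Duality: pairing the gradient at `x + y` with `x + y` gives the squared norm, while each
separate pairing is at most `‖x + y‖` times a norm. -/
theorem wNorm_add_le {μ : X → ℝ} (hμ : ∀ i, 0 < μ i) {p : ℝ} (hp : 2 ≤ p) (x y : X → ℝ) :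
    wNorm μ p (x + y) ≤ wNorm μ p x + wNorm μ p y := by
  have hN := wNorm_nonneg hμ p
  rcases (hN (x + y)).eq_or_lt with h | h
  · rw [← h]
    exact add_nonneg (hN x) (hN y)
  · have h1 := wGrad_pair_self hμ hp (x + y)
    simp only [Pi.add_apply, mul_add, Finset.sum_add_distrib] at h1
    have h2 := (le_abs_self _).trans (abs_wGrad_pair_le hμ hp (x + y) x)
    have h3 := (le_abs_self _).trans (abs_wGrad_pair_le hμ hp (x + y) y)
    refine le_of_mul_le_mul_left ?_ h
    nlinarith

theorem wNorm_sub_le {μ : X → ℝ} (hμ : ∀ i, 0 < μ i) {p : ℝ} (hp : 2 ≤ p) (x y : X → ℝ) :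
    wNorm μ p (x - y) ≤ wNorm μ p x + wNorm μ p y := by
  rw [sub_eq_add_neg, ← wNorm_neg μ p y]
  exact wNorm_add_le hμ hp _ _

theorem wNorm_smul {μ : X → ℝ} (hμ : ∀ i, 0 < μ i) {p : ℝ} (hp : 2 ≤ p) {r : ℝ} (hr : 0 ≤ r)
    (x : X → ℝ) : wNorm μ p (r • x) = r * wNorm μ p x := by
  have hp0 : 0 < p := by linarith
  refine (Real.rpow_left_inj (wNorm_nonneg hμ _ _) (mul_nonneg hr (wNorm_nonneg hμ _ _))
    hp0.ne').1 ?_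
  rw [Real.mul_rpow hr (wNorm_nonneg hμ _ _), wNorm_rpow hμ hp, wNorm_rpow hμ hp, Finset.mul_sum]
  refine Finset.sum_congr rfl fun i _ => ?_
  rw [Pi.smul_apply, smul_eq_mul, abs_mul, Real.mul_rpow (abs_nonneg _) (abs_nonneg _),
    abs_of_nonneg hr]
  ring

/-- Bernoulli needs an exponent at least one, so it is used at `q + 1`; `r ^ (q + 1) ≤ r ^ q` then
covers all `q ≥ 0`. -/
theorem one_sub_rpow_le {r q : ℝ} (hr0 : 0 ≤ r) (hr1 : r ≤ 1) (hq : 0 ≤ q) :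
    1 - r ^ q ≤ (q + 1) * (1 - r) := by
  have h1 := one_add_mul_self_le_rpow_one_add (s := r - 1) (by linarith) (p := q + 1) (by linarith)
  have h2 : r ^ (q + 1) ≤ r ^ q := by
    rw [Real.rpow_add_one' hr0 (by linarith)]
    exact mul_le_of_le_one_right (Real.rpow_nonneg hr0 _) hr1
  rw [show 1 + (r - 1) = r by ring] at h1
  linarith

/-- The extra factor `a` on the left gives both sides the same homogeneity, so the case `b = 1`
suffices. It serves both the coordinates and the norms in the Lipschitz estimate for the gradient.
-/
theorem mul_rpow_sub_rpow_le {a b q : ℝ} (ha : 0 ≤ a) (hab : a ≤ b) (hq : 0 ≤ q) :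
    (b ^ q - a ^ q) * a ≤ (q + 1) * b ^ q * (b - a) := by
  rcases (ha.trans hab).eq_or_lt with hb | hb
  · have : a = 0 := by linarith
    subst hb this
    simp
  · have h1 := one_sub_rpow_le (div_nonneg ha hb.le) ((div_le_one hb).2 hab) hq
    rw [Real.div_rpow ha hb.le] at h1
    have hbq := Real.rpow_pos_of_pos hb q
    have h2 : b ^ q - a ^ q ≤ (q + 1) * b ^ q * ((b - a) / b) := by
      calc b ^ q - a ^ q = b ^ q * (1 - a ^ q / b ^ q) := by field_simp
        _ ≤ b ^ q * ((q + 1) * (1 - a / b)) := mul_le_mul_of_nonneg_left h1 hbq.le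
        _ = _ := by field_simp
    calc (b ^ q - a ^ q) * a ≤ ((q + 1) * b ^ q * ((b - a) / b)) * b := by
          have h3 : 0 ≤ (q + 1) * b ^ q * ((b - a) / b) :=
            mul_nonneg (mul_nonneg (by linarith) hbq.le) (div_nonneg (by linarith) hb.le)
          nlinarith [Real.rpow_le_rpow ha hab hq]
      _ = _ := by field_simp

theorem abs_rpow_mul_sub_le_of_le {p : ℝ} (hp : 2 ≤ p) {a b : ℝ} (hab : |a| ≤ |b|) :
    |(|b| ^ (p - 2) * b - |a| ^ (p - 2) * a)| ≤ p * |b| ^ (p - 2) * |b - a| := by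
  have hq : 0 ≤ p - 2 := by linarith
  have h1 : |b| ^ (p - 2) * b - |a| ^ (p - 2) * a =
      |b| ^ (p - 2) * (b - a) + (|b| ^ (p - 2) - |a| ^ (p - 2)) * a := by ring
  have hb := Real.rpow_nonneg (abs_nonneg b) (p - 2)
  rw [h1]
  refine (abs_add_le _ _).trans ?_
  rw [abs_mul, abs_mul, abs_of_nonneg hb,
    abs_of_nonneg (sub_nonneg.2 (Real.rpow_le_rpow (abs_nonneg _) hab hq))]
  have h2 := mul_rpow_sub_rpow_le (abs_nonneg a) hab hq
  have h3 : |b| - |a| ≤ |b - a| := abs_sub_abs_le_abs_sub b a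
  have h4 := mul_le_mul_of_nonneg_left h3 (mul_nonneg (show 0 ≤ p - 2 + 1 by linarith) hb)
  nlinarith

theorem abs_rpow_mul_sub_le {p : ℝ} (hp : 2 ≤ p) (a b : ℝ) :
    |(|b| ^ (p - 2) * b - |a| ^ (p - 2) * a)| ≤
      p * (|a| ^ (p - 2) * |b - a| + |b| ^ (p - 2) * |b - a|) := by
  have ha := mul_nonneg (Real.rpow_nonneg (abs_nonneg a) (p - 2)) (abs_nonneg (b - a))
  have hb := mul_nonneg (Real.rpow_nonneg (abs_nonneg b) (p - 2)) (abs_nonneg (b - a))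
  rcases le_total |a| |b| with h | h
  · have := abs_rpow_mul_sub_le_of_le hp h
    nlinarith
  · have := abs_rpow_mul_sub_le_of_le hp h
    rw [abs_sub_comm, abs_sub_comm a b] at this
    nlinarith

/-- The gradient is a norm power times a coordinatewise power, and its variation splits accordingly.
The coordinates contribute `2p` and the norm power `p - 1`, which `3p` covers. -/
theorem abs_wGrad_sub_pair_le_of_le {μ : X → ℝ} (hμ : ∀ i, 0 < μ i) {p : ℝ} (hp : 2 ≤ p)
    (a b h : X → ℝ) (hab : wNorm μ p a ≤ wNorm μ p b) :
    |∑ i, (wGrad μ p b i - wGrad μ p a i) * h i| ≤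
      3 * p * wNorm μ p (b - a) * wNorm μ p h := by
  have hq : 0 ≤ p - 2 := by linarith
  have hN := wNorm_nonneg hμ p
  have hD : wNorm μ p b ≤ wNorm μ p a + wNorm μ p (b - a) := by
    simpa using wNorm_add_le hμ hp a (b - a)
  have ht1 := trilinear_le hμ hp a (b - a) h
  have ht2 := trilinear_le hμ hp b (b - a) h
  have ht3 := trilinear_le hμ hp a a h
  set A := wNorm μ p a with hA
  set B := wNorm μ p b with hB
  set D := wNorm μ p (b - a)
  set H := wNorm μ p h
  have hD0 : 0 ≤ D := hN _
  have hH0 : 0 ≤ H := hN _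
  rcases (hN b).eq_or_lt with hb | hb
  · have ha : A = 0 := le_antisymm (hab.trans hb.symm.le) (hN a)
    have e1 := eq_zero_of_wNorm_eq_zero hμ hp hb.symm
    have e2 := eq_zero_of_wNorm_eq_zero hμ hp ha
    simp only [wGrad, e1, e2]
    simp
    positivity
  · have hB2 : 0 < B ^ (2 - p) := Real.rpow_pos_of_pos hb _
    have hBB : B ^ (2 - p) * B ^ (p - 2) = 1 := by
      rw [← Real.rpow_add hb]; simp
    have hAB : A ^ (p - 2) ≤ B ^ (p - 2) := Real.rpow_le_rpow (hN a) hab hq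
    have hsplit : ∑ i, (wGrad μ p b i - wGrad μ p a i) * h i =
        B ^ (2 - p) * (∑ i, μ i * (|b i| ^ (p - 2) * b i - |a i| ^ (p - 2) * a i) * h i) +
        (B ^ (2 - p) - A ^ (2 - p)) * ∑ i, μ i * (|a i| ^ (p - 2) * a i * h i) := by
      rw [Finset.mul_sum, Finset.mul_sum, ← Finset.sum_add_distrib]
      refine Finset.sum_congr rfl fun i _ => ?_
      unfold wGrad
      rw [← hA, ← hB]
      ring
    have h1 : |∑ i, μ i * (|b i| ^ (p - 2) * b i - |a i| ^ (p - 2) * a i) * h i| ≤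
        p * (A ^ (p - 2) * D * H + B ^ (p - 2) * D * H) := by
      refine (Finset.abs_sum_le_sum_abs _ _).trans ?_
      refine le_trans ?_ (mul_le_mul_of_nonneg_left (add_le_add ht1 ht2) (by linarith))
      rw [← Finset.sum_add_distrib, Finset.mul_sum]
      refine Finset.sum_le_sum fun i _ => ?_
      rw [abs_mul, abs_mul, abs_of_pos (hμ i)]
      have := mul_le_mul_of_nonneg_left (mul_le_mul_of_nonneg_right
        (abs_rpow_mul_sub_le hp (a i) (b i)) (abs_nonneg (h i))) (hμ i).le
      calc _ = μ i * (|(|b i| ^ (p - 2) * b i - |a i| ^ (p - 2) * a i)| * |h i|) := by ring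
        _ ≤ _ := this
        _ = _ := by simp only [Pi.sub_apply]; ring
    have h2 : |∑ i, μ i * (|a i| ^ (p - 2) * a i * h i)| ≤ A ^ (p - 2) * A * H := by
      refine (Finset.abs_sum_le_sum_abs _ _).trans (le_trans (le_of_eq ?_) ht3)
      refine Finset.sum_congr rfl fun i _ => ?_
      rw [abs_mul, abs_mul, abs_mul, abs_of_pos (hμ i),
        abs_of_nonneg (Real.rpow_nonneg (abs_nonneg (a i)) _)]
    -- The possible blow-up of `A ^ (2 - p)` for small `A` is cancelled by `A ^ (p - 2) * A`,
    -- leaving only an increment of `B ^ (p - 2)`.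
    have h3 : |B ^ (2 - p) - A ^ (2 - p)| * (A ^ (p - 2) * A * H) ≤ (p - 1) * D * H := by
      rcases (hN a).eq_or_lt with ha | ha
      · rw [← hA] at ha
        rw [← ha]
        simp
        exact mul_nonneg (mul_nonneg (by linarith) hD0) hH0
      · rw [← hA] at ha
        have hAA : A ^ (2 - p) * A ^ (p - 2) = 1 := by
          rw [← Real.rpow_add ha]; simp
        have hBA : B ^ (2 - p) ≤ A ^ (2 - p) :=
          Real.rpow_le_rpow_of_nonpos ha hab (by linarith)
        rw [abs_sub_comm, abs_of_nonneg (sub_nonneg.2 hBA)]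
        have h4 := mul_rpow_sub_rpow_le ha.le hab hq
        have h5 : (A ^ (2 - p) - B ^ (2 - p)) * (A ^ (p - 2) * A * H) =
            B ^ (2 - p) * ((B ^ (p - 2) - A ^ (p - 2)) * A) * H := by
          linear_combination (A * H) * hAA - (A * H) * hBB
        rw [h5]
        calc B ^ (2 - p) * ((B ^ (p - 2) - A ^ (p - 2)) * A) * H
            ≤ B ^ (2 - p) * ((p - 2 + 1) * B ^ (p - 2) * (B - A)) * H := by gcongr
          _ = (p - 1) * (B - A) * H := by
            linear_combination ((p - 1) * (B - A) * H) * hBB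
          _ ≤ (p - 1) * D * H := by
            refine mul_le_mul_of_nonneg_right (mul_le_mul_of_nonneg_left ?_ ?_) hH0 <;> linarith
    rw [hsplit]
    refine (abs_add_le _ _).trans ?_
    rw [abs_mul, abs_mul, abs_of_pos hB2]
    have h6 : B ^ (2 - p) * |∑ i, μ i * (|b i| ^ (p - 2) * b i - |a i| ^ (p - 2) * a i) * h i| ≤
        2 * p * D * H := by
      refine (mul_le_mul_of_nonneg_left h1 hB2.le).trans ?_
      have h7 : A ^ (p - 2) * D * H ≤ B ^ (p - 2) * D * H := by gcongr
      calc _ ≤ B ^ (2 - p) * (p * (B ^ (p - 2) * D * H + B ^ (p - 2) * D * H)) := by gcongr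
        _ = 2 * p * D * H := by linear_combination (2 * p * D * H) * hBB
    have h8 := mul_le_mul_of_nonneg_left h2 (abs_nonneg (B ^ (2 - p) - A ^ (2 - p)))
    have h9 : 0 ≤ D * H := by positivity
    nlinarith

theorem abs_wGrad_sub_pair_le {μ : X → ℝ} (hμ : ∀ i, 0 < μ i) {p : ℝ} (hp : 2 ≤ p)
    (a b h : X → ℝ) :
    |∑ i, (wGrad μ p b i - wGrad μ p a i) * h i| ≤
      3 * p * wNorm μ p (b - a) * wNorm μ p h := by
  rcases le_total (wNorm μ p a) (wNorm μ p b) with hab | hab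
  · exact abs_wGrad_sub_pair_le_of_le hμ hp a b h hab
  · have := abs_wGrad_sub_pair_le_of_le hμ hp b a h hab
    rw [wNorm_sub_comm, ← abs_neg, ← Finset.sum_neg_distrib] at this
    refine le_trans (le_of_eq ?_) this
    congr 1
    exact Finset.sum_congr rfl fun i _ => by ring

/-- Smoothness of the squared weighted `ℓ_p`-norm. -/
theorem wNorm_add_sq_le {μ : X → ℝ} (hμ : ∀ i, 0 < μ i) {p : ℝ} (hp : 2 ≤ p) (x y : X → ℝ) :
    wNorm μ p (x + y) ^ 2 ≤
      wNorm μ p x ^ 2 + 2 * ∑ i, wGrad μ p x i * y i + 6 * p * wNorm μ p y ^ 2 := by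
  -- No differentiation is needed: `‖x + y‖²` is the pairing of the gradient at `x + y` with `x`
  -- plus that with `y`. The first is at most `(‖x‖² + ‖x + y‖²)/2`; in the second the gradient is
  -- moved to `x` at cost `3p‖y‖²`. Doubling gives `6p`.
  have h1 := wGrad_pair_self hμ hp (x + y)
  have h2 := (le_abs_self _).trans (abs_wGrad_pair_le hμ hp (x + y) x)
  have h3 := (le_abs_self _).trans (abs_wGrad_sub_pair_le hμ hp x (x + y) y)
  simp only [Pi.add_apply, mul_add, Finset.sum_add_distrib] at h1
  simp only [sub_mul, Finset.sum_sub_distrib, add_sub_cancel_left] at h3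
  nlinarith [sq_nonneg (wNorm μ p x - wNorm μ p (x + y))]

end WeightedNorm

/-! ### Substochastic matrices: resolvents, almost invariant weights, contraction. -/

section Substochastic

variable {X : Type*} [Fintype X]

/-- Maximum principle: at a coordinate of largest modulus, a null vector `v = B v` would satisfy
`|v| ≤ r |v|`. -/
theorem isUnit_one_sub_of_row_sum_le [DecidableEq X] {B : Matrix X X ℝ} (hB : ∀ x y, 0 ≤ B x y)
    {r : ℝ} (hr : r < 1) (hrow : ∀ x, ∑ y, B x y ≤ r) : IsUnit (1 - B) := by
  rw [Matrix.isUnit_iff_isUnit_det, isUnit_iff_ne_zero]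
  intro hdet
  obtain ⟨v, hv0, hv⟩ := Matrix.exists_mulVec_eq_zero_iff.2 hdet
  have hv' : ∀ x, v x = ∑ y, B x y * v y := by
    intro x
    have := congrFun hv x
    rw [Matrix.sub_mulVec, Matrix.one_mulVec, Pi.sub_apply, Pi.zero_apply, sub_eq_zero] at this
    exact this
  obtain ⟨x₁, hx₁⟩ := Function.ne_iff.1 hv0
  have : Nonempty X := ⟨x₁⟩
  obtain ⟨x₀, hx₀⟩ := Finite.exists_max fun x => |v x|
  have hpos : 0 < |v x₀| := (abs_pos.2 hx₁).trans_le (hx₀ x₁)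
  have h1 : |v x₀| ≤ r * |v x₀| := by
    calc |v x₀| = |∑ y, B x₀ y * v y| := by rw [← hv']
      _ ≤ ∑ y, B x₀ y * |v x₀| := by
        refine (Finset.abs_sum_le_sum_abs _ _).trans (Finset.sum_le_sum fun y _ => ?_)
        rw [abs_mul, abs_of_nonneg (hB _ _)]
        exact mul_le_mul_of_nonneg_left (hx₀ y) (hB _ _)
      _ ≤ r * |v x₀| := by
        rw [← Finset.sum_mul]
        exact mul_le_mul_of_nonneg_right (hrow x₀) hpos.le
  nlinarith

/-- The negative part of `ν` is dominated by its own image under `B`, which shrinks total mass by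
the factor `r < 1`; hence it is zero. -/
theorem nonneg_of_eq_sum_add {B : Matrix X X ℝ} (hB : ∀ x y, 0 ≤ B x y)
    {r : ℝ} (hr : r < 1) (hrow : ∀ x, ∑ y, B x y ≤ r) {ν u : X → ℝ} (hu : ∀ x, 0 ≤ u x)
    (hν : ∀ y, ν y = ∑ x, ν x * B x y + u y) (y : X) : 0 ≤ ν y := by
  have h1 : ∀ y, max 0 (-ν y) ≤ ∑ x, max 0 (-ν x) * B x y := by
    intro y
    refine max_le (Finset.sum_nonneg fun x _ => mul_nonneg (le_max_left _ _) (hB _ _)) ?_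
    have h2 : -ν y ≤ ∑ x, -ν x * B x y := by
      simp only [neg_mul, Finset.sum_neg_distrib]
      linarith [hν y, hu y]
    exact h2.trans (Finset.sum_le_sum fun x _ =>
      mul_le_mul_of_nonneg_right (le_max_right _ _) (hB _ _))
  have hnn : ∀ y, 0 ≤ max 0 (-ν y) := fun y => le_max_left _ _
  have h3 : ∑ y, max 0 (-ν y) ≤ r * ∑ x, max 0 (-ν x) := by
    refine (Finset.sum_le_sum fun y _ => h1 y).trans ?_
    rw [Finset.sum_comm, Finset.mul_sum]
    refine Finset.sum_le_sum fun x _ => ?_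
    rw [← Finset.mul_sum, mul_comm]
    exact mul_le_mul_of_nonneg_right (hrow x) (hnn x)
  have h4 : max 0 (-ν y) ≤ ∑ y, max 0 (-ν y) :=
    Finset.single_le_sum (fun y _ => hnn y) (Finset.mem_univ y)
  have h5 : 0 ≤ ∑ y, max 0 (-ν y) := Finset.sum_nonneg fun y _ => hnn y
  have h6 : ∑ y, max 0 (-ν y) = 0 := by nlinarith
  have := (le_max_right 0 (-ν y)).trans (h4.trans h6.le)
  linarith

/-- A nonnegative matrix with row sums at most `1 - w` has an almost invariant weight vector. -/
theorem exists_weight [DecidableEq X] [Nonempty X] {G : Matrix X X ℝ} (hG : ∀ x y, 0 ≤ G x y)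
    {w : ℝ} (hw : 0 < w) (hrow : ∀ x, ∑ y, G x y ≤ 1 - w) {θ : ℝ} (hθ₀ : 0 < θ) (hθ₁ : θ < 1) :
    ∃ μ : X → ℝ, (∑ x, μ x = 1) ∧ (∀ x, 0 < μ x) ∧
      (∀ x, w * (1 - θ) / ((1 - θ * w) * Fintype.card X) ≤ μ x) ∧
      ∀ y, ∑ x, μ x * G x y ≤ (1 - θ * w) * μ y := by
  have hw1 : w ≤ 1 := by
    obtain ⟨x⟩ := ‹Nonempty X›
    have := (Finset.sum_nonneg fun y _ => hG x y).trans (hrow x)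
    linarith
  have hs : 0 < 1 - θ * w := by nlinarith
  set s := 1 - θ * w with hs_def
  -- Dividing by `s` leaves row sums at most `r = (1 - w)/s < 1`, since `θ < 1`. The solution of `ν
  -- (1 - B) = 1` satisfies `ν B = ν - 1 ≤ ν`, that is `ν G ≤ s ν`. Also `ν ≥ 1` while its mass is
  -- at most `card X / (1 - r)`, and `1 - r = w(1 - θ)/s`; normalizing gives the lower bound on the
  -- weights.
  set B : Matrix X X ℝ := Matrix.of fun x y => G x y / s with hBdef
  have hB : ∀ x y, 0 ≤ B x y := fun x y => div_nonneg (hG x y) hs.le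
  set r := (1 - w) / s with hr_def
  have hr : r < 1 := by rw [hr_def, div_lt_one hs]; nlinarith
  have hBrow : ∀ x, ∑ y, B x y ≤ r := by
    intro x
    simp only [hBdef, Matrix.of_apply]
    rw [← Finset.sum_div]
    exact div_le_div_of_nonneg_right (hrow x) hs.le
  obtain ⟨ν, hν⟩ := Matrix.vecMul_surjective_iff_isUnit.2
    (isUnit_one_sub_of_row_sum_le hB hr hBrow) (fun _ => 1)
  have hν' : ∀ y, ν y = ∑ x, ν x * B x y + 1 := by
    intro y
    have h1 : Matrix.vecMul ν (1 - B) y = 1 := congrFun hν y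
    rw [Matrix.vecMul_sub, Matrix.vecMul_one, Pi.sub_apply] at h1
    simp only [Matrix.vecMul, dotProduct] at h1
    linarith
  have hν0 := nonneg_of_eq_sum_add hB hr hBrow (fun _ => zero_le_one) hν'
  have hν1 : ∀ y, 1 ≤ ν y := fun y => by
    rw [hν' y]
    linarith [Finset.sum_nonneg fun x (_ : x ∈ Finset.univ) => mul_nonneg (hν0 x) (hB x y)]
  set N := ∑ y, ν y with hN
  have hcard : (0 : ℝ) < Fintype.card X := by exact_mod_cast Fintype.card_pos
  have hN1 : Fintype.card X ≤ N := by
    calc (Fintype.card X : ℝ) = ∑ _y : X, (1 : ℝ) := by simp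
      _ ≤ N := Finset.sum_le_sum fun y _ => hν1 y
  have hN0 : 0 < N := hcard.trans_le hN1
  have hN2 : N ≤ r * N + Fintype.card X := by
    calc N = ∑ y, (∑ x, ν x * B x y + 1) := Finset.sum_congr rfl fun y _ => hν' y
      _ = ∑ x, ν x * ∑ y, B x y + Fintype.card X := by
        rw [Finset.sum_add_distrib, Finset.sum_comm]
        simp [Finset.mul_sum]
      _ ≤ r * N + Fintype.card X := by
        rw [hN, Finset.mul_sum]
        refine add_le_add_left (Finset.sum_le_sum fun x _ => ?_) _
        rw [mul_comm]
        exact mul_le_mul_of_nonneg_right (hBrow x) (hν0 x)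
  refine ⟨fun x => ν x / N, ?_, fun x => div_pos (by linarith [hν1 x]) hN0, fun x => ?_,
    fun y => ?_⟩
  · rw [← Finset.sum_div, div_self hN0.ne']
  · have h1 : w * (1 - θ) / s = 1 - r := by
      rw [hr_def, one_sub_div hs.ne', hs_def]
      congr 1
      ring
    rw [← div_div, h1, div_le_div_iff₀ hcard hN0]
    nlinarith [hν1 x]
  · have h1 := hν' y
    have h2 : ∑ x, ν x * B x y = (∑ x, ν x * G x y) / s := by
      rw [Finset.sum_div]
      exact Finset.sum_congr rfl fun x _ => by simp [hBdef, mul_div_assoc]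
    have h3 : ∑ x, ν x * G x y ≤ s * ν y := by
      rw [h2] at h1
      have : (∑ x, ν x * G x y) / s ≤ ν y := by linarith
      rw [div_le_iff₀ hs] at this
      linarith
    calc ∑ x, ν x / N * G x y = (∑ x, ν x * G x y) / N := by
          rw [Finset.sum_div]
          exact Finset.sum_congr rfl fun x _ => by ring
      _ ≤ s * ν y / N := div_le_div_of_nonneg_right h3 hN0.le
      _ = _ := by ring

theorem rpow_sub_one_mul_le_weighted {p : ℝ} (hp : 2 ≤ p) {a h : ℝ} (ha : 0 ≤ a) (hh : 0 ≤ h) :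
    a ^ (p - 2) * a * h ≤ (1 - 1 / p) * a ^ p + 1 / p * h ^ p := by
  have h1 := rpow_mul_mul_le_weighted hp ha ha hh
  have h2 : (p - 2) / p * a ^ p + 1 / p * a ^ p = (1 - 1 / p) * a ^ p := by
    field_simp
    ring
  linarith

/-- One-sided contraction estimate for a nonnegative matrix with respect to almost invariant
weights. -/
theorem wGrad_pair_mulVec_le {μ : X → ℝ} (hμ : ∀ i, 0 < μ i) {p : ℝ} (hp : 2 ≤ p)
    {G : Matrix X X ℝ} (hG : ∀ x y, 0 ≤ G x y) {w θ : ℝ} (hw : 0 ≤ w) (hθ₁ : θ ≤ 1)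
    (hrow : ∀ x, ∑ y, G x y ≤ 1 - w)
    (hμG : ∀ y, ∑ x, μ x * G x y ≤ (1 - θ * w) * μ y) (v : X → ℝ) :
    ∑ i, wGrad μ p v i * G.mulVec v i ≤ (1 - (1 + θ) / 2 * w) * wNorm μ p v ^ 2 := by
  have hp0 : 0 < p := by linarith
  have hN := wNorm_nonneg hμ p v
  rcases hN.eq_or_lt with h0 | h0
  · simp [wGrad, ← h0, eq_zero_of_wNorm_eq_zero hμ hp h0.symm]
  have hpw : ∀ x y, |v x| ^ (p - 2) * |v x| * |v y| ≤
      (1 - 1 / p) * |v x| ^ p + 1 / p * |v y| ^ p := fun x y =>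
    rpow_sub_one_mul_le_weighted hp (abs_nonneg _) (abs_nonneg _)
  have h1p : 0 ≤ 1 - 1 / p := by
    rw [sub_nonneg, div_le_one hp0]; linarith
  have h1 : ∑ i, wGrad μ p v i * G.mulVec v i ≤ wNorm μ p v ^ (2 - p) *
      ∑ x, ∑ y, μ x * G x y * ((1 - 1 / p) * |v x| ^ p + 1 / p * |v y| ^ p) := by
    rw [Finset.mul_sum]
    refine Finset.sum_le_sum fun x _ => ?_
    unfold wGrad Matrix.mulVec dotProduct
    rw [mul_assoc]
    refine mul_le_mul_of_nonneg_left ?_ (Real.rpow_nonneg hN _)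
    rw [Finset.mul_sum]
    refine Finset.sum_le_sum fun y _ => ?_
    refine le_trans ?_ (mul_le_mul_of_nonneg_left (hpw x y) (mul_nonneg (hμ x).le (hG x y)))
    have h2 : v x * v y ≤ |v x| * |v y| := by rw [← abs_mul]; exact le_abs_self _
    calc _ = (μ x * G x y * |v x| ^ (p - 2)) * (v x * v y) := by ring
      _ ≤ (μ x * G x y * |v x| ^ (p - 2)) * (|v x| * |v y|) :=
        mul_le_mul_of_nonneg_left h2 (mul_nonneg (mul_nonneg (hμ x).le (hG x y))
          (Real.rpow_nonneg (abs_nonneg _) _))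
      _ = _ := by ring
  have h2 : ∑ x, ∑ y, μ x * G x y * ((1 - 1 / p) * |v x| ^ p + 1 / p * |v y| ^ p) ≤
      ((1 - 1 / p) * (1 - w) + 1 / p * (1 - θ * w)) * wNorm μ p v ^ p := by
    simp only [mul_add, Finset.sum_add_distrib]
    rw [add_mul]
    refine add_le_add ?_ ?_
    · rw [wNorm_rpow hμ hp, Finset.mul_sum]
      refine Finset.sum_le_sum fun x _ => ?_
      calc ∑ y, μ x * G x y * ((1 - 1 / p) * |v x| ^ p)
          = (1 - 1 / p) * (μ x * |v x| ^ p) * ∑ y, G x y := by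
            rw [Finset.mul_sum]
            exact Finset.sum_congr rfl fun y _ => by ring
        _ ≤ (1 - 1 / p) * (μ x * |v x| ^ p) * (1 - w) :=
            mul_le_mul_of_nonneg_left (hrow x) (mul_nonneg h1p
              (mul_nonneg (hμ x).le (Real.rpow_nonneg (abs_nonneg _) _)))
        _ = _ := by ring
    · rw [Finset.sum_comm, wNorm_rpow hμ hp, Finset.mul_sum]
      refine Finset.sum_le_sum fun y _ => ?_
      rw [← Finset.sum_mul]
      calc (∑ x, μ x * G x y) * (1 / p * |v y| ^ p)
          ≤ ((1 - θ * w) * μ y) * (1 / p * |v y| ^ p) :=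
            mul_le_mul_of_nonneg_right (hμG y) (mul_nonneg (by positivity)
              (Real.rpow_nonneg (abs_nonneg _) _))
        _ = _ := by ring
  have h3 : wNorm μ p v ^ (2 - p) * wNorm μ p v ^ p = wNorm μ p v ^ 2 := by
    rw [← Real.rpow_add h0, ← Real.rpow_natCast]
    congr 1
    push_cast
    ring
  -- Row sums are the better bound, and `p ≥ 2` gives them at least half of the total weight; this
  -- is the source of `(1 + θ)/2`.
  have h4 : (1 - 1 / p) * (1 - w) + 1 / p * (1 - θ * w) ≤ 1 - (1 + θ) / 2 * w := by
    have : 1 / p ≤ 1 / 2 := one_div_le_one_div_of_le (by norm_num) hp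
    have h5 : 0 ≤ (1 - θ) * w := mul_nonneg (by linarith) hw
    nlinarith
  refine h1.trans ((mul_le_mul_of_nonneg_left h2 (Real.rpow_nonneg hN _)).trans ?_)
  calc _ = ((1 - 1 / p) * (1 - w) + 1 / p * (1 - θ * w)) *
        (wNorm μ p v ^ (2 - p) * wNorm μ p v ^ p) := by ring
    _ ≤ _ := by
      rw [h3]
      exact mul_le_mul_of_nonneg_right h4 (sq_nonneg _)

end Substochastic

/-! ### Stationary distributions and mixing of finite Markov chains. -/

section MarkovChain

variable {S : Type*} [Fintype S]

/-- Constants are right null vectors of `P - 1`, so there is a left null vector `ν`. Entrywise `|ν|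
≤ |ν| P` with equal totals forces equality, and `|ν|` can be normalized. -/
theorem exists_isStationaryDist [DecidableEq S] [Nonempty S] {P : Matrix S S ℝ}
    (hP : ∀ s s', 0 ≤ P s s') (hP1 : ∀ s, ∑ s', P s s' = 1) : ∃ κ, IsStationaryDist P κ := by
  have hdet : (P - 1).det = 0 := by
    refine Matrix.exists_mulVec_eq_zero_iff.1 ⟨fun _ => 1, ?_, ?_⟩
    · obtain ⟨s⟩ := ‹Nonempty S›
      exact fun h => one_ne_zero (congrFun h s)
    · ext s
      simp [Matrix.mulVec, dotProduct, hP1, Matrix.one_apply]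
  obtain ⟨ν, hν0, hν⟩ := Matrix.exists_vecMul_eq_zero_iff.2 hdet
  have hν' : ∀ y, ν y = ∑ x, ν x * P x y := by
    intro y
    have := congrFun hν y
    rw [Matrix.vecMul_sub, Matrix.vecMul_one, Pi.sub_apply] at this
    simp only [Matrix.vecMul, dotProduct, Pi.zero_apply] at this
    linarith
  have h1 : ∀ y ∈ Finset.univ, |ν y| ≤ ∑ x, |ν x| * P x y := by
    intro y _
    rw [hν' y]
    refine (Finset.abs_sum_le_sum_abs _ _).trans (le_of_eq (Finset.sum_congr rfl fun x _ => ?_))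
    rw [abs_mul, abs_of_nonneg (hP x y)]
  have h2 : ∑ y, |ν y| = ∑ y, ∑ x, |ν x| * P x y := by
    rw [Finset.sum_comm]
    simp [← Finset.mul_sum, hP1]
  have h3 := (Finset.sum_eq_sum_iff_of_le h1).1 h2
  have hpos : 0 < ∑ y, |ν y| := by
    obtain ⟨s, hs⟩ := Function.ne_iff.1 hν0
    exact Finset.sum_pos' (fun y _ => abs_nonneg _) ⟨s, Finset.mem_univ s, abs_pos.2 hs⟩
  refine ⟨fun s => |ν s| / ∑ y, |ν y|, fun s => div_nonneg (abs_nonneg _) hpos.le, ?_, fun s => ?_⟩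
  · rw [← Finset.sum_div, div_self hpos.ne']
  · calc ∑ x, |ν x| / (∑ y, |ν y|) * P x s = (∑ x, |ν x| * P x s) / ∑ y, |ν y| := by
          rw [Finset.sum_div]
          exact Finset.sum_congr rfl fun x _ => by ring
      _ = |ν s| / ∑ y, |ν y| := by rw [← h3 s (Finset.mem_univ s)]

/-- Doeblin contraction: `d` has total mass zero, so subtracting `ε` from every entry of `A` changes
nothing, but lowers the row sums of a still nonnegative matrix. -/
theorem sum_abs_vecMul_le {A : Matrix S S ℝ} {ε : ℝ} (hA : ∀ s s', ε ≤ A s s')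
    (hA1 : ∀ s, ∑ s', A s s' = 1) {d : S → ℝ} (hd : ∑ s, d s = 0) :
    ∑ s', |∑ s, d s * A s s'| ≤ (1 - Fintype.card S * ε) * ∑ s, |d s| := by
  calc ∑ s', |∑ s, d s * A s s'| ≤ ∑ s', ∑ s, |d s| * (A s s' - ε) := by
        refine Finset.sum_le_sum fun s' _ => ?_
        have h1 : ∑ s, d s * A s s' = ∑ s, d s * (A s s' - ε) := by
          simp only [mul_sub, Finset.sum_sub_distrib]
          rw [← Finset.sum_mul, hd]
          ring
        rw [h1]
        refine (Finset.abs_sum_le_sum_abs _ _).trans (le_of_eq (Finset.sum_congr rfl fun s _ => ?_))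
        rw [abs_mul, abs_of_nonneg (sub_nonneg.2 (hA s s'))]
    _ = (1 - Fintype.card S * ε) * ∑ s, |d s| := by
        rw [Finset.sum_comm]
        simp only [← Finset.mul_sum, Finset.sum_sub_distrib, hA1]
        rw [← Finset.sum_mul]
        simp [mul_comm]

variable [DecidableEq S]

theorem pow_apply_nonneg {P : Matrix S S ℝ} (hP : ∀ s s', 0 ≤ P s s') (k : ℕ) (s s' : S) :
    0 ≤ (P ^ k) s s' := by
  induction k generalizing s s' with
  | zero => rw [pow_zero, Matrix.one_apply]; split_ifs <;> norm_num
  | succ k ih =>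
    rw [pow_succ, Matrix.mul_apply]
    exact Finset.sum_nonneg fun x _ => mul_nonneg (ih _ _) (hP _ _)

theorem pow_row_sum {P : Matrix S S ℝ} (hP1 : ∀ s, ∑ s', P s s' = 1) (k : ℕ) (s : S) :
    ∑ s', (P ^ k) s s' = 1 := by
  induction k generalizing s with
  | zero => simp [Matrix.one_apply]
  | succ k ih =>
    simp only [pow_succ, Matrix.mul_apply]
    rw [Finset.sum_comm]
    simp [← Finset.mul_sum, hP1, ih]

theorem IsStationaryDist.sum_mul_pow {P : Matrix S S ℝ} {κ : S → ℝ} (h : IsStationaryDist P κ)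
    (k : ℕ) (s' : S) : ∑ s, κ s * (P ^ k) s s' = κ s' := by
  induction k generalizing s' with
  | zero => simp [Matrix.one_apply]
  | succ k ih =>
    simp only [pow_succ, Matrix.mul_apply, Finset.mul_sum]
    rw [Finset.sum_comm]
    simp only [← mul_assoc, ← Finset.sum_mul, ih]
    exact h.2.2 s'

theorem pow_add_apply_pos {P : Matrix S S ℝ} (hP : ∀ s s', 0 ≤ P s s') {i j : ℕ} {x y z : S}
    (h1 : 0 < (P ^ i) x y) (h2 : 0 < (P ^ j) y z) : 0 < (P ^ (i + j)) x z := by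
  rw [pow_add, Matrix.mul_apply]
  exact Finset.sum_pos' (fun w _ => mul_nonneg (pow_apply_nonneg hP _ _ _)
    (pow_apply_nonneg hP _ _ _)) ⟨y, Finset.mem_univ y, mul_pos h1 h2⟩

theorem IsStationaryDist.pos {P : Matrix S S ℝ} {κ : S → ℝ} (h : IsStationaryDist P κ)
    (hP : ∀ s s', 0 ≤ P s s') (hirr : IrreducibleChain P) (s' : S) : 0 < κ s' := by
  have h1 : ∃ s, 0 < κ s := by
    by_contra! hc
    have := Finset.sum_nonpos fun s (_ : s ∈ Finset.univ) => hc s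
    linarith [h.2.1]
  obtain ⟨s, hs⟩ := h1
  obtain ⟨k, hk⟩ := hirr s s'
  rw [← h.sum_mul_pow k s']
  exact Finset.sum_pos' (fun x _ => mul_nonneg (h.1 x) (pow_apply_nonneg hP _ _ _))
    ⟨s, Finset.mem_univ s, mul_pos hs hk⟩

/-- Return times are closed under addition, and a set of naturals with gcd one generates all large
integers. -/
theorem exists_forall_ge_return_pos {P : Matrix S S ℝ} (hP : ∀ s s', 0 ≤ P s s')
    (haper : AperiodicChain P) (s : S) : ∃ m, ∀ k ≥ m, 0 < (P ^ k) s s := by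
  set R : Set ℕ := {k | 1 ≤ k ∧ 0 < (P ^ k) s s} with hR
  have hgcd : Nat.setGcd R = 1 :=
    haper s _ fun k hk hk' => Nat.setGcd_dvd_of_mem (s := R) ⟨hk, hk'⟩
  obtain ⟨m, hm⟩ := Nat.exists_mem_closure_of_ge R
  refine ⟨m, fun k hk => ?_⟩
  have h1 := hm k hk (by rw [hgcd]; exact one_dvd k)
  refine AddSubmonoid.closure_induction (motive := fun k _ => 0 < (P ^ k) s s) (fun k hk => hk.2)
    (by simp) (fun i j _ _ hi hj => pow_add_apply_pos hP hi hj) h1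

/-- Take `N` beyond all thresholds and connecting times together: from `s`, first loop for the
surplus time, then walk to `s'`. -/
theorem exists_pow_pos {P : Matrix S S ℝ} (hP : ∀ s s', 0 ≤ P s s')
    (hirr : IrreducibleChain P) (haper : AperiodicChain P) :
    ∃ N, ∀ s s', 0 < (P ^ N) s s' := by
  choose m hm using exists_forall_ge_return_pos hP haper
  choose d hd using hirr
  refine ⟨∑ s, m s + ∑ s, ∑ s', d s s', fun s s' => ?_⟩
  have h1 : m s ≤ ∑ s, m s := Finset.single_le_sum (fun _ _ => Nat.zero_le _) (Finset.mem_univ s)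
  have h2 : d s s' ≤ ∑ s, ∑ s', d s s' :=
    (Finset.single_le_sum (f := d s) (fun _ _ => Nat.zero_le _) (Finset.mem_univ s')).trans
      (Finset.single_le_sum (f := fun s => ∑ s', d s s') (fun _ _ => Nat.zero_le _)
        (Finset.mem_univ s))
  obtain ⟨e, he⟩ : ∃ e, ∑ s, m s + ∑ s, ∑ s', d s s' = e + d s s' :=
    ⟨_, (Nat.sub_add_cancel (h2.trans (Nat.le_add_left _ _))).symm⟩
  rw [he]
  exact pow_add_apply_pos hP (hm s e (by omega)) (hd s s')

/-- Convergence to stationarity of an irreducible aperiodic finite Markov chain. -/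
theorem exists_tvDist_pow_le [Nonempty S] {P : Matrix S S ℝ} (hP : ∀ s s', 0 ≤ P s s')
    (hP1 : ∀ s, ∑ s', P s s' = 1) (hirr : IrreducibleChain P) (haper : AperiodicChain P)
    {κ : S → ℝ} (hκ : IsStationaryDist P κ) {δ : ℝ} (hδ : 0 < δ) :
    ∃ k : ℕ, ∀ s, tvDist (fun s' => (P ^ k) s s') κ ≤ δ := by
  obtain ⟨N, hN⟩ := exists_pow_pos hP hirr haper
  obtain ⟨⟨a, b⟩, hab⟩ := Finite.exists_min fun x : S × S => (P ^ N) x.1 x.2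
  set ε := (P ^ N) a b with hε
  have hε0 : 0 < ε := hN a b
  have hA : ∀ s s', ε ≤ (P ^ N) s s' := fun s s' => hab (s, s')
  have hA1 := pow_row_sum hP1 N
  have hcard : (0 : ℝ) < Fintype.card S := by exact_mod_cast Fintype.card_pos
  set r := 1 - Fintype.card S * ε with hr
  have hr1 : r < 1 := by rw [hr]; nlinarith
  have hr0 : 0 ≤ r := by
    have : ∑ _s' : S, ε ≤ 1 := by
      rw [← hA1 a]; exact Finset.sum_le_sum fun s' _ => hA a s'
    simp at this
    linarith
  have key : ∀ (m : ℕ) (s : S), ∑ s', |(P ^ (N * m)) s s' - κ s'| ≤ r ^ m * 2 := by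
    intro m s
    induction m with
    | zero =>
      simp only [mul_zero, pow_zero, one_mul]
      calc ∑ s', |(1 : Matrix S S ℝ) s s' - κ s'|
          ≤ ∑ s', ((1 : Matrix S S ℝ) s s' + κ s') := by
            refine Finset.sum_le_sum fun s' _ => ?_
            have h1 : 0 ≤ (1 : Matrix S S ℝ) s s' := pow_apply_nonneg hP 0 s s'
            exact abs_le.2 ⟨by linarith [hκ.1 s'], by linarith [hκ.1 s']⟩
        _ = 2 := by
            rw [Finset.sum_add_distrib, hκ.2.1]
            simp [Matrix.one_apply]
            norm_num
    | succ m ih =>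
      have h1 : ∀ s', (P ^ (N * (m + 1))) s s' - κ s' =
          ∑ x, ((P ^ (N * m)) s x - κ x) * (P ^ N) x s' := by
        intro s'
        simp only [sub_mul, Finset.sum_sub_distrib]
        rw [hκ.sum_mul_pow, mul_add, mul_one, pow_add, Matrix.mul_apply]
      simp only [h1]
      refine (sum_abs_vecMul_le hA hA1 ?_).trans ?_
      · rw [Finset.sum_sub_distrib, pow_row_sum hP1, hκ.2.1, sub_self]
      · rw [pow_succ, mul_comm (r ^ m) r, mul_assoc]
        exact mul_le_mul_of_nonneg_left ih hr0
  obtain ⟨m, hm⟩ := exists_pow_lt_of_lt_one hδ hr1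
  refine ⟨N * m, fun s => ?_⟩
  unfold tvDist
  linarith [key m s]

theorem isStationaryDist_stationaryDist [Nonempty S] {P : Matrix S S ℝ}
    (hP : ∀ s s', 0 ≤ P s s') (hP1 : ∀ s, ∑ s', P s s' = 1) :
    IsStationaryDist P (stationaryDist P) :=
  Classical.epsilon_spec (exists_isStationaryDist hP hP1)

/-- Convergence is needed so that the set in the definition is nonempty; otherwise `sInf` would
return the meaningless value `0`. -/
theorem tvDist_mixingTime_le [Nonempty S] {P : Matrix S S ℝ} (hP : ∀ s s', 0 ≤ P s s')
    (hP1 : ∀ s, ∑ s', P s s' = 1) (hirr : IrreducibleChain P) (haper : AperiodicChain P)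
    {δ : ℝ} (hδ : 0 < δ) (s : S) :
    tvDist (fun s' => (P ^ mixingTime P δ) s s') (stationaryDist P) ≤ δ :=
  Nat.sInf_mem (s := {k : ℕ | ∀ s, tvDist (fun s' => (P ^ k) s s') (stationaryDist P) ≤ δ})
    (exists_tvDist_pow_le hP hP1 hirr haper (isStationaryDist_stationaryDist hP hP1) hδ) s

end MarkovChain

theorem geomF_eq_sum (n : ℕ) (x : ℝ) : geomF n x = ∑ i ∈ Finset.range n, x ^ i := by
  unfold geomF
  split_ifs with h
  · simp [h]
  · rw [geom_sum_eq h, ← neg_sub, ← neg_sub x 1, neg_div_neg_eq]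

theorem one_le_geomF {n : ℕ} (hn : 1 ≤ n) {x : ℝ} (hx : 0 ≤ x) : 1 ≤ geomF n x := by
  rw [geomF_eq_sum]
  have := Finset.single_le_sum (f := fun i => x ^ i) (s := Finset.range n)
    (fun i _ => pow_nonneg hx i) (Finset.mem_range.2 hn)
  simpa using this

/-! ### State-action kernels, mean increment and Bellman matrix. -/

section Kernel

variable {S A : Type*} [Fintype S] [Fintype A] (M : MDP S A) (πb : Policy S A)

/-- Transition matrix of the state-action chain, weighted by the ratio `c` at the target. -/
def ratioKernel (c : S × A → ℝ) : Matrix (S × A) (S × A) ℝ :=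
  Matrix.of fun x y => M.trans x.2 x.1 y.1 * πb.prob y.1 y.2 * c y

theorem ratioKernel_nonneg {c : S × A → ℝ} (hc : ∀ x, 0 ≤ c x) (x y : S × A) :
    0 ≤ ratioKernel M πb c x y :=
  mul_nonneg (mul_nonneg (M.trans_nonneg _ _ _) (πb.prob_nonneg _ _)) (hc y)

theorem ratioKernel_mono {c ρ : S × A → ℝ} (h : ∀ x, c x ≤ ρ x) (x y : S × A) :
    ratioKernel M πb c x y ≤ ratioKernel M πb ρ x y :=
  mul_le_mul_of_nonneg_left (h y) (mul_nonneg (M.trans_nonneg _ _ _) (πb.prob_nonneg _ _))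

theorem ratioKernel_mulVec (c g : S × A → ℝ) (x : S × A) :
    (ratioKernel M πb c).mulVec g x =
      ∑ s', M.trans x.2 x.1 s' * ∑ a', πb.prob s' a' * (c (s', a') * g (s', a')) := by
  simp only [Matrix.mulVec, dotProduct, ratioKernel, Matrix.of_apply, Fintype.sum_prod_type,
    Finset.mul_sum]
  exact Finset.sum_congr rfl fun _ _ => Finset.sum_congr rfl fun _ _ => by ring

theorem ratioKernel_row_sum (c : S × A → ℝ) (x : S × A) :
    ∑ y, ratioKernel M πb c x y = ∑ s', M.trans x.2 x.1 s' * diagD πb c s' := by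
  have := ratioKernel_mulVec M πb c (fun _ => 1) x
  simpa [Matrix.mulVec, dotProduct, diagD] using this

theorem ratioKernel_row_sum_le (c : S × A → ℝ) (x : S × A) :
    ∑ y, ratioKernel M πb c x y ≤ ⨆ s, diagD πb c s := by
  rw [ratioKernel_row_sum]
  calc ∑ s', M.trans x.2 x.1 s' * diagD πb c s'
      ≤ ∑ s', M.trans x.2 x.1 s' * ⨆ s, diagD πb c s :=
        Finset.sum_le_sum fun s' _ => mul_le_mul_of_nonneg_left
          (le_ciSup (Set.finite_range _).bddAbove s') (M.trans_nonneg _ _ _)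
    _ = _ := by rw [← Finset.sum_mul, M.trans_sum, one_mul]

theorem le_ratioKernel_row_sum (c : S × A → ℝ) (x : S × A) :
    ⨅ s, diagD πb c s ≤ ∑ y, ratioKernel M πb c x y := by
  rw [ratioKernel_row_sum]
  calc ⨅ s, diagD πb c s = ∑ s', M.trans x.2 x.1 s' * ⨅ s, diagD πb c s := by
        rw [← Finset.sum_mul, M.trans_sum, one_mul]
    _ ≤ _ := Finset.sum_le_sum fun s' _ => mul_le_mul_of_nonneg_left
          (ciInf_le (Set.finite_range _).bddBelow s') (M.trans_nonneg _ _ _)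

theorem ratioKernel_one_row_sum (x : S × A) : ∑ y, ratioKernel M πb (fun _ => 1) x y = 1 := by
  rw [ratioKernel_row_sum]
  simp [diagD, πb.prob_sum, M.trans_sum]

theorem abs_ratioKernel_mulVec_le {c : S × A → ℝ} (hc : ∀ x, 0 ≤ c x) {g : S × A → ℝ} {r : ℝ}
    (hg : ∀ y, |g y| ≤ r) (x : S × A) :
    |(ratioKernel M πb c).mulVec g x| ≤ (⨆ y, c y) * r := by
  have hr : 0 ≤ r := (abs_nonneg _).trans (hg x)
  calc |∑ y, ratioKernel M πb c x y * g y|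
      ≤ ∑ y, ratioKernel M πb (fun _ => 1) x y * ((⨆ y, c y) * r) := by
        refine (Finset.abs_sum_le_sum_abs _ _).trans (Finset.sum_le_sum fun y _ => ?_)
        rw [abs_mul, abs_of_nonneg (ratioKernel_nonneg M πb hc x y)]
        have h1 : c y * |g y| ≤ (⨆ y, c y) * r :=
          mul_le_mul (le_ciSup (Set.finite_range _).bddAbove y) (hg y) (abs_nonneg _)
            ((hc y).trans (le_ciSup (Set.finite_range _).bddAbove y))
        have h2 := mul_le_mul_of_nonneg_left h1
          (ratioKernel_nonneg M πb (c := fun _ => 1) (fun _ => zero_le_one) x y)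
        refine le_trans (le_of_eq ?_) h2
        simp only [ratioKernel, Matrix.of_apply]
        ring
    _ = _ := by rw [← Finset.sum_mul, ratioKernel_one_row_sum, one_mul]

/-- Conditional mean of the temporal difference given the current state-action pair. -/
def tdMean (ρ q : S × A → ℝ) : S × A → ℝ :=
  fun x => M.reward x + M.disc * (ratioKernel M πb ρ).mulVec q x - q x

theorem tdMean_sub (ρ q q' : S × A → ℝ) :
    tdMean M πb ρ q - tdMean M πb ρ q' =
      fun x => M.disc * (ratioKernel M πb ρ).mulVec (q - q') x - (q - q') x := by
  ext x
  simp only [tdMean, Matrix.mulVec_sub, Pi.sub_apply]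
  ring

theorem abs_tdMean_sub_le {ρ : S × A → ℝ} (hρ : ∀ x, 0 ≤ ρ x) {q q' : S × A → ℝ} {r : ℝ}
    (h : ∀ x, |(q - q') x| ≤ r) (x : S × A) :
    |(tdMean M πb ρ q - tdMean M πb ρ q') x| ≤ (M.disc * (⨆ x, ρ x) + 1) * r := by
  rw [tdMean_sub]
  refine (abs_sub _ _).trans ?_
  rw [abs_mul, abs_of_pos M.disc_pos, add_mul, one_mul, mul_assoc]
  exact add_le_add (mul_le_mul_of_nonneg_left (abs_ratioKernel_mulVec_le M πb hρ h x)
    M.disc_pos.le) (h x)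

theorem abs_tdMean_le {ρ : S × A → ℝ} (hρ : ∀ x, 0 ≤ ρ x) {q : S × A → ℝ} {r : ℝ}
    (h : ∀ x, |q x| ≤ r) (x : S × A) :
    |tdMean M πb ρ q x| ≤ 1 + (M.disc * (⨆ x, ρ x) + 1) * r := by
  have h1 := abs_tdMean_sub_le M πb hρ (q := q) (q' := 0) (by simpa using h) x
  have h2 : tdMean M πb ρ q x = M.reward x + (tdMean M πb ρ q - tdMean M πb ρ 0) x := by
    simp [tdMean]
  rw [h2]
  refine (abs_add_le _ _).trans (add_le_add ?_ h1)
  rw [abs_of_nonneg (M.reward_nonneg x)]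
  exact M.reward_le_one x

theorem stateChain_nonneg (s s' : S) : 0 ≤ stateChain M πb s s' :=
  Finset.sum_nonneg fun _ _ => mul_nonneg (πb.prob_nonneg _ _) (M.trans_nonneg _ _ _)

theorem stateChain_row_sum (s : S) : ∑ s', stateChain M πb s s' = 1 := by
  simp only [stateChain, Matrix.of_apply]
  rw [Finset.sum_comm]
  simp [← Finset.mul_sum, M.trans_sum, πb.prob_sum]

theorem stationarySA_nonneg [Nonempty S] (x : S × A) : 0 ≤ stationarySA M πb x := by
  classical
  exact mul_nonneg ((isStationaryDist_stationaryDist (stateChain_nonneg M πb)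
    (stateChain_row_sum M πb)).1 _) (πb.prob_nonneg _ _)

theorem stationarySA_le_one [Nonempty S] (x : S × A) : stationarySA M πb x ≤ 1 := by
  classical
  have h1 : ∑ x, stationarySA M πb x = 1 := by
    simp only [stationarySA, Fintype.sum_prod_type, ← Finset.mul_sum, πb.prob_sum, mul_one]
    exact (isStationaryDist_stationaryDist (stateChain_nonneg M πb)
      (stateChain_row_sum M πb)).2.1
  rw [← h1]
  exact Finset.single_le_sum (fun y _ => stationarySA_nonneg M πb y) (Finset.mem_univ x)

variable [DecidableEq S]

theorem stationarySA_pos [Nonempty S] (hπb : ∀ s a, 0 < πb.prob s a)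
    (hirr : IrreducibleChain (stateChain M πb)) (x : S × A) : 0 < stationarySA M πb x :=
  mul_pos ((isStationaryDist_stationaryDist (stateChain_nonneg M πb)
    (stateChain_row_sum M πb)).pos (stateChain_nonneg M πb) hirr _) (hπb _ _)

theorem omega_pos [Nonempty S] [Nonempty A] (hπb : ∀ s a, 0 < πb.prob s a)
    (hirr : IrreducibleChain (stateChain M πb)) {n : ℕ} (hn : 1 ≤ n) {c ρ : S × A → ℝ}
    (hc : ∀ x, 0 ≤ c x) (hD : (⨆ s, diagD πb ρ s) < 1 / M.disc) : 0 < omega M πb n c ρ := by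
  have hr : M.disc * (⨆ s, diagD πb ρ s) < 1 := by
    rwa [lt_div_iff₀ M.disc_pos, mul_comm] at hD
  have h1 : 0 < ⨅ x, stationarySA M πb x := by
    obtain ⟨x, hx⟩ := exists_eq_ciInf_of_finite (f := stationarySA M πb)
    rw [← hx]
    exact stationarySA_pos M πb hπb hirr x
  have hDc : 0 ≤ ⨅ s, diagD πb c s := Real.iInf_nonneg fun s =>
    Finset.sum_nonneg fun a _ => mul_nonneg (πb.prob_nonneg _ _) (hc _)
  have h2 := one_le_geomF hn (mul_nonneg M.disc_pos.le hDc)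
  exact mul_pos (mul_pos h1 (by linarith)) (by linarith)

variable [DecidableEq A]

/-- The matrix `∑_{i < n} (γ P_c)^i`. -/
def traceSum (n : ℕ) (c : S × A → ℝ) : Matrix (S × A) (S × A) ℝ :=
  ∑ i ∈ Finset.range n, M.disc ^ i • ratioKernel M πb c ^ i

theorem traceSum_mulVec (n : ℕ) (c g : S × A → ℝ) (x : S × A) :
    (traceSum M πb n c).mulVec g x =
      ∑ i ∈ Finset.range n, M.disc ^ i * (ratioKernel M πb c ^ i).mulVec g x := by
  simp [traceSum, Matrix.sum_mulVec, Matrix.smul_mulVec]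

theorem traceSum_nonneg (n : ℕ) {c : S × A → ℝ} (hc : ∀ x, 0 ≤ c x) (x y : S × A) :
    0 ≤ traceSum M πb n c x y := by
  simp only [traceSum, Matrix.sum_apply, Matrix.smul_apply, smul_eq_mul]
  exact Finset.sum_nonneg fun i _ => mul_nonneg (pow_nonneg M.disc_pos.le _)
    (pow_apply_nonneg (ratioKernel_nonneg M πb hc) _ _ _)

theorem abs_traceSum_mulVec_le (n : ℕ) {c : S × A → ℝ} (hc : ∀ x, 0 ≤ c x) {g : S × A → ℝ}
    {r : ℝ} (hg : ∀ y, |g y| ≤ r) (x : S × A) :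
    |(traceSum M πb n c).mulVec g x| ≤ geomF n (M.disc * ⨆ y, c y) * r := by
  have h1 : ∀ i x, |(ratioKernel M πb c ^ i).mulVec g x| ≤ (⨆ y, c y) ^ i * r := by
    intro i
    induction i with
    | zero => simpa using hg
    | succ i ih =>
      intro x
      rw [pow_succ', ← Matrix.mulVec_mulVec, pow_succ', mul_assoc]
      exact abs_ratioKernel_mulVec_le M πb hc ih x
  rw [traceSum_mulVec, geomF_eq_sum, Finset.sum_mul]
  refine (Finset.abs_sum_le_sum_abs _ _).trans (Finset.sum_le_sum fun i _ => ?_)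
  rw [abs_mul, abs_of_nonneg (pow_nonneg M.disc_pos.le i), mul_pow, mul_assoc]
  exact mul_le_mul_of_nonneg_left (h1 i x) (pow_nonneg M.disc_pos.le i)

theorem geomF_le_traceSum_row_sum (n : ℕ) {c : S × A → ℝ} (hc : ∀ x, 0 ≤ c x) (x : S × A) :
    geomF n (M.disc * ⨅ s, diagD πb c s) ≤ ∑ y, traceSum M πb n c x y := by
  have hD : 0 ≤ ⨅ s, diagD πb c s := Real.iInf_nonneg fun s =>
    Finset.sum_nonneg fun a _ => mul_nonneg (πb.prob_nonneg _ _) (hc _)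
  have h1 : ∀ i x, (⨅ s, diagD πb c s) ^ i ≤ (ratioKernel M πb c ^ i).mulVec (fun _ => 1) x := by
    intro i
    induction i with
    | zero => simp
    | succ i ih =>
      intro x
      rw [pow_succ', pow_succ', ← Matrix.mulVec_mulVec]
      calc (⨅ s, diagD πb c s) * (⨅ s, diagD πb c s) ^ i
          ≤ (∑ y, ratioKernel M πb c x y) * (⨅ s, diagD πb c s) ^ i :=
            mul_le_mul_of_nonneg_right (le_ratioKernel_row_sum M πb c x) (pow_nonneg hD i)
        _ ≤ _ := by
          rw [Finset.sum_mul]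
          exact Finset.sum_le_sum fun y _ =>
            mul_le_mul_of_nonneg_left (ih y) (ratioKernel_nonneg M πb hc x y)
  have h2 : ∑ y, traceSum M πb n c x y = (traceSum M πb n c).mulVec (fun _ => 1) x := by
    simp [Matrix.mulVec, dotProduct]
  rw [h2, traceSum_mulVec, geomF_eq_sum]
  refine Finset.sum_le_sum fun i _ => ?_
  rw [mul_pow]
  exact mul_le_mul_of_nonneg_left (h1 i x) (pow_nonneg M.disc_pos.le i)

/-- The fixed-point equation is linear with matrix `1 - γ P_ρ`, invertible because its substochastic
part has row sums at most `γ D_{ρ,max} < 1`. So `Classical.epsilon` selects a genuine fixed point.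
-/
theorem opH_limitQ [Nonempty S] {ρ : S × A → ℝ} (hρ : ∀ x, 0 ≤ ρ x)
    (hD : (⨆ s, diagD πb ρ s) < 1 / M.disc) : opH M πb ρ (limitQ M πb ρ) = limitQ M πb ρ := by
  refine Classical.epsilon_spec (p := fun Q => opH M πb ρ Q = Q) ?_
  have hr : M.disc * (⨆ s, diagD πb ρ s) < 1 := by
    rwa [lt_div_iff₀ M.disc_pos, mul_comm] at hD
  have hu : IsUnit (1 - M.disc • ratioKernel M πb ρ) := by
    refine isUnit_one_sub_of_row_sum_le (fun x y => mul_nonneg M.disc_pos.le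
      (ratioKernel_nonneg M πb hρ x y)) hr fun x => ?_
    simp only [Matrix.smul_apply, smul_eq_mul, ← Finset.mul_sum]
    exact mul_le_mul_of_nonneg_left (ratioKernel_row_sum_le M πb ρ x) M.disc_pos.le
  obtain ⟨Q, hQ⟩ := Matrix.mulVec_surjective_iff_isUnit.2 hu M.reward
  refine ⟨Q, funext fun x => ?_⟩
  have h1 : (1 - M.disc • ratioKernel M πb ρ).mulVec Q x = M.reward x := congrFun hQ x
  rw [Matrix.sub_mulVec, Matrix.one_mulVec, Pi.sub_apply, Matrix.smul_mulVec, Pi.smul_apply,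
    smul_eq_mul, ratioKernel_mulVec] at h1
  unfold opH
  linarith

theorem tdMean_limitQ [Nonempty S] {ρ : S × A → ℝ} (hρ : ∀ x, 0 ≤ ρ x)
    (hD : (⨆ s, diagD πb ρ s) < 1 / M.disc) : tdMean M πb ρ (limitQ M πb ρ) = 0 := by
  ext x
  have := congrFun (opH_limitQ M πb hρ hD) x
  rw [opH, ← ratioKernel_mulVec] at this
  simp [tdMean, this]

/-- The stationary mean increment of the algorithm. -/
noncomputable def meanInc (n : ℕ) (c ρ q : S × A → ℝ) : S × A → ℝ :=
  fun x => stationarySA M πb x * (traceSum M πb n c).mulVec (tdMean M πb ρ q) x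

/-- The linear part of the asynchronous generalized Bellman operator. -/
noncomputable def bellmanMatrix (n : ℕ) (c ρ : S × A → ℝ) : Matrix (S × A) (S × A) ℝ :=
  1 + Matrix.diagonal (stationarySA M πb) *
    (traceSum M πb n c * (M.disc • ratioKernel M πb ρ - 1))

theorem meanInc_eq [Nonempty S] (n : ℕ) (c : S × A → ℝ) {ρ : S × A → ℝ} (hρ : ∀ x, 0 ≤ ρ x)
    (hD : (⨆ s, diagD πb ρ s) < 1 / M.disc) (q : S × A → ℝ) :
    meanInc M πb n c ρ q =
      (bellmanMatrix M πb n c ρ).mulVec (q - limitQ M πb ρ) - (q - limitQ M πb ρ) := by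
  have h1 : tdMean M πb ρ q =
      (M.disc • ratioKernel M πb ρ - 1).mulVec (q - limitQ M πb ρ) := by
    have := tdMean_sub M πb ρ q (limitQ M πb ρ)
    rw [tdMean_limitQ M πb hρ hD, sub_zero] at this
    rw [this, Matrix.sub_mulVec, Matrix.one_mulVec, Matrix.smul_mulVec]
    rfl
  unfold bellmanMatrix
  rw [Matrix.add_mulVec, Matrix.one_mulVec, ← Matrix.mulVec_mulVec, ← Matrix.mulVec_mulVec, ← h1,
    add_sub_cancel_left]
  ext x
  rw [Matrix.mulVec_diagonal]
  rfl

/-- Telescoping that removes the minus signs: if `0 ≤ B ≤ E` entrywise, every term on the right is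
nonnegative. Stated for any ring because the two kernels need not commute. -/
theorem geom_sum_mul_sub_one_add_one {R : Type*} [Ring R] (B E : R) (m : ℕ) :
    (∑ i ∈ Finset.range (m + 1), B ^ i) * (E - 1) + 1 =
      (∑ i ∈ Finset.range m, B ^ i) * (E - B) + B ^ m * E := by
  induction m with
  | zero => simp
  | succ m ih =>
    rw [Finset.sum_range_succ, add_mul, add_right_comm, ih, Finset.sum_range_succ _ m, add_mul,
      pow_succ]
    noncomm_ring

/-- Row `x` is a convex combination, with weight `stationarySA`, of the identity and the synchronous
operator `T(E - 1) + 1`; the latter is nonnegative by the telescoping identity, where `c ≤ ρ`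
enters. -/
theorem bellmanMatrix_nonneg [Nonempty S] {n : ℕ} (hn : 1 ≤ n) {c ρ : S × A → ℝ}
    (hc : ∀ x, 0 ≤ c x) (hcρ : ∀ x, c x ≤ ρ x) (x y : S × A) :
    0 ≤ bellmanMatrix M πb n c ρ x y := by
  obtain ⟨m, rfl⟩ := Nat.exists_eq_add_of_le' hn
  set B := M.disc • ratioKernel M πb c
  set E := M.disc • ratioKernel M πb ρ with hE
  have hB : ∀ x y, 0 ≤ B x y := fun x y => mul_nonneg M.disc_pos.le (ratioKernel_nonneg M πb hc x y)
  have hE0 : ∀ x y, 0 ≤ E x y := fun x y => mul_nonneg M.disc_pos.le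
    (ratioKernel_nonneg M πb (fun x => (hc x).trans (hcρ x)) x y)
  have hEB : ∀ x y, 0 ≤ (E - B) x y := fun x y => sub_nonneg.2
    (mul_le_mul_of_nonneg_left (ratioKernel_mono M πb hcρ x y) M.disc_pos.le)
  have hT : traceSum M πb (m + 1) c = ∑ i ∈ Finset.range (m + 1), B ^ i := by
    simp [traceSum, B, smul_pow]
  have hW : ∀ x y, 0 ≤ (traceSum M πb (m + 1) c * (E - 1) + 1) x y := by
    intro x y
    rw [hT, geom_sum_mul_sub_one_add_one, Matrix.add_apply, Matrix.mul_apply, Matrix.mul_apply]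
    refine add_nonneg (Finset.sum_nonneg fun z _ => mul_nonneg ?_ (hEB _ _))
      (Finset.sum_nonneg fun z _ => mul_nonneg (pow_apply_nonneg hB _ _ _) (hE0 _ _))
    rw [Matrix.sum_apply]
    exact Finset.sum_nonneg fun i _ => pow_apply_nonneg hB _ _ _
  have h1 : bellmanMatrix M πb (m + 1) c ρ x y =
      (1 - stationarySA M πb x) * (1 : Matrix (S × A) (S × A) ℝ) x y +
        stationarySA M πb x * (traceSum M πb (m + 1) c * (E - 1) + 1) x y := by
    rw [bellmanMatrix, ← hE, Matrix.add_apply, Matrix.diagonal_mul, Matrix.add_apply]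
    ring
  rw [h1]
  exact add_nonneg (mul_nonneg (sub_nonneg.2 (stationarySA_le_one M πb x))
    (pow_apply_nonneg hB 0 x y)) (mul_nonneg (stationarySA_nonneg M πb x) (hW x y))

/-- The deficit of row `x` is exactly its stationary mass times a trace-weighted sum of deficits of
`γ P_ρ`. Bounding the three ingredients by their extremes gives the three factors of `omega`. -/
theorem bellmanMatrix_row_sum_le [Nonempty S] {n : ℕ} {c ρ : S × A → ℝ} (hc : ∀ x, 0 ≤ c x)
    (hD : (⨆ s, diagD πb ρ s) < 1 / M.disc) (x : S × A) :
    ∑ y, bellmanMatrix M πb n c ρ x y ≤ 1 - omega M πb n c ρ := by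
  have hr : M.disc * (⨆ s, diagD πb ρ s) < 1 := by
    rwa [lt_div_iff₀ M.disc_pos, mul_comm] at hD
  have h1 : ∑ y, bellmanMatrix M πb n c ρ x y = 1 - stationarySA M πb x *
      ∑ z, traceSum M πb n c x z * (1 - M.disc * ∑ y, ratioKernel M πb ρ z y) := by
    have h2 : ∑ y, bellmanMatrix M πb n c ρ x y =
        (bellmanMatrix M πb n c ρ).mulVec (fun _ => 1) x := by simp [Matrix.mulVec, dotProduct]
    have h3 : (M.disc • ratioKernel M πb ρ - 1).mulVec (fun _ => 1) =
        -fun z => 1 - M.disc * ∑ y, ratioKernel M πb ρ z y := by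
      ext z
      simp [Matrix.mulVec, dotProduct, Matrix.one_apply, Finset.mul_sum]
    rw [h2, bellmanMatrix, Matrix.add_mulVec, Matrix.one_mulVec, ← Matrix.mulVec_mulVec,
      ← Matrix.mulVec_mulVec, h3, Matrix.mulVec_neg, Pi.add_apply, Matrix.mulVec_diagonal,
      Pi.neg_apply, mul_neg, ← sub_eq_add_neg]
    rfl
  rw [h1]
  refine sub_le_sub_left ?_ 1
  have hDc : 0 ≤ ⨅ s, diagD πb c s := Real.iInf_nonneg fun s =>
    Finset.sum_nonneg fun a _ => mul_nonneg (πb.prob_nonneg _ _) (hc _)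
  have hf : 0 ≤ geomF n (M.disc * ⨅ s, diagD πb c s) := by
    rw [geomF_eq_sum]
    exact Finset.sum_nonneg fun i _ => pow_nonneg (mul_nonneg M.disc_pos.le hDc) i
  rw [omega, mul_assoc]
  refine mul_le_mul (ciInf_le (Set.finite_range _).bddBelow x) ?_
    (mul_nonneg hf (by linarith)) (stationarySA_nonneg M πb x)
  refine (mul_le_mul_of_nonneg_right (geomF_le_traceSum_row_sum M πb n hc x)
    (by linarith)).trans ?_
  rw [Finset.sum_mul]
  refine Finset.sum_le_sum fun z _ => mul_le_mul_of_nonneg_left ?_ (traceSum_nonneg M πb n hc x z)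
  have := mul_le_mul_of_nonneg_left (ratioKernel_row_sum_le M πb ρ z) M.disc_pos.le
  linarith

/-- Actions depend only on the current state, so after one transition the pair follows the state
chain. Hence the state-action chain mixes one step later than the state chain. -/
theorem ratioKernel_one_pow_succ (t : ℕ) (x y : S × A) :
    (ratioKernel M πb (fun _ => 1) ^ (t + 1)) x y =
      ∑ s, M.trans x.2 x.1 s * ((stateChain M πb ^ t) s y.1 * πb.prob y.1 y.2) := by
  induction t generalizing y with
  | zero => simp [ratioKernel, Matrix.one_apply]
  | succ t ih =>
    rw [pow_succ, Matrix.mul_apply, Fintype.sum_prod_type]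
    simp only [ih, pow_succ _ t, Matrix.mul_apply, Finset.sum_mul, Finset.mul_sum]
    rw [Finset.sum_congr rfl fun _ _ => Finset.sum_comm, Finset.sum_comm]
    refine Finset.sum_congr rfl fun s _ => Finset.sum_congr rfl fun s' _ => ?_
    simp only [ratioKernel, stateChain, Matrix.of_apply, Finset.mul_sum, Finset.sum_mul]
    exact Finset.sum_congr rfl fun a _ => by ring

/-- Mixing of the state-action chain. -/
theorem sum_abs_ratioKernel_pow_sub_le [Nonempty S]
    (hirr : IrreducibleChain (stateChain M πb)) (haper : AperiodicChain (stateChain M πb))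
    {δ : ℝ} (hδ : 0 < δ) (x : S × A) :
    ∑ y, |(ratioKernel M πb (fun _ => 1) ^ (mixingTime (stateChain M πb) δ + 1)) x y -
      stationarySA M πb y| ≤ 2 * δ := by
  set t := mixingTime (stateChain M πb) δ
  set κ := stationaryDist (stateChain M πb)
  have h1 : ∀ y : S × A, |(ratioKernel M πb (fun _ => 1) ^ (t + 1)) x y - stationarySA M πb y| ≤
      ∑ s, M.trans x.2 x.1 s * (|(stateChain M πb ^ t) s y.1 - κ y.1| * πb.prob y.1 y.2) := by
    intro y
    have h2 : (ratioKernel M πb (fun _ => 1) ^ (t + 1)) x y - stationarySA M πb y =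
        ∑ s, M.trans x.2 x.1 s * (((stateChain M πb ^ t) s y.1 - κ y.1) * πb.prob y.1 y.2) := by
      rw [ratioKernel_one_pow_succ]
      simp only [sub_mul, mul_sub, Finset.sum_sub_distrib]
      rw [← Finset.sum_mul, M.trans_sum, one_mul]
      rfl
    rw [h2]
    refine (Finset.abs_sum_le_sum_abs _ _).trans (le_of_eq (Finset.sum_congr rfl fun s _ => ?_))
    rw [abs_mul, abs_mul, abs_of_nonneg (M.trans_nonneg _ _ _),
      abs_of_nonneg (πb.prob_nonneg _ _)]
  refine (Finset.sum_le_sum fun y _ => h1 y).trans ?_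
  rw [Finset.sum_comm]
  calc ∑ s, ∑ y : S × A,
        M.trans x.2 x.1 s * (|(stateChain M πb ^ t) s y.1 - κ y.1| * πb.prob y.1 y.2)
      = ∑ s, M.trans x.2 x.1 s * ∑ s', |(stateChain M πb ^ t) s s' - κ s'| := by
        refine Finset.sum_congr rfl fun s _ => ?_
        rw [← Finset.mul_sum, Fintype.sum_prod_type]
        simp [← Finset.mul_sum, πb.prob_sum]
    _ ≤ ∑ s, M.trans x.2 x.1 s * (2 * δ) := by
        refine Finset.sum_le_sum fun s _ => mul_le_mul_of_nonneg_left ?_ (M.trans_nonneg _ _ _)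
        have := tvDist_mixingTime_le (stateChain_nonneg M πb) (stateChain_row_sum M πb) hirr haper
          hδ s
        unfold tvDist at this
        linarith
    _ = 2 * δ := by rw [← Finset.sum_mul, M.trans_sum, one_mul]

end Kernel

/-! ### Markov property of the trajectory and conditional expectations. -/

section Trajectory

open MeasureTheory

variable {S A : Type*} [Fintype S] [Fintype A]
  {M : MDP S A} {πb : Policy S A} {Ω : Type*} [MeasurableSpace Ω] {Pr : Measure Ω}
  {Z : ℕ → Ω → S × A}

/-- The sequence following a finite path and then staying at its last point. -/
def extendPath {X : Type*} (m : ℕ) (w : Fin (m + 1) → X) : ℕ → X :=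
  fun i => w ⟨min i m, Nat.lt_succ_of_le (min_le_right _ _)⟩

theorem extendPath_apply {X : Type*} {m : ℕ} (z : ℕ → X) {i : ℕ} (hi : i ≤ m) :
    extendPath m (fun i : Fin (m + 1) => z i) i = z i := by
  simp [extendPath, min_eq_left hi]

theorem extendPath_eq {X : Type*} {m : ℕ} {w : Fin (m + 1) → X} {z : ℕ → X}
    (h : ∀ i ≤ m, z i = extendPath m w i) : w = fun i : Fin (m + 1) => z i := by
  funext i
  have hi : (i : ℕ) ≤ m := Nat.le_of_lt_succ i.2
  rw [h i hi]
  simp [extendPath, min_eq_left hi]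

theorem IsTrajectory.measurableSet_cylinder (hZ : IsTrajectory M πb Pr Z) (m : ℕ) (z : ℕ → S × A) :
    MeasurableSet {w | ∀ i ≤ m, Z i w = z i} := by
  have : {w | ∀ i ≤ m, Z i w = z i} = ⋂ i, ⋂ (_ : i ≤ m), {w | Z i w = z i} := by
    ext w
    simp
  rw [this]
  exact MeasurableSet.iInter fun i => MeasurableSet.iInter fun _ => hZ.1 i (z i)

/-- Extending a path by one point multiplies its prescribed probability by one more factor: the
Markov property on cylinders. -/
theorem IsTrajectory.real_cylinder_inter (hZ : IsTrajectory M πb Pr Z) (m : ℕ) (z : ℕ → S × A)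
    (y : S × A) :
    Pr.real ({w | ∀ i ≤ m, Z i w = z i} ∩ {w | Z (m + 1) w = y}) =
      Pr.real {w | ∀ i ≤ m, Z i w = z i} * ratioKernel M πb (fun _ => 1) (z m) y := by
  have hz : ∀ i ≤ m, Function.update z (m + 1) y i = z i := fun i hi =>
    Function.update_of_ne (by omega) _ _
  have h1 : {w | ∀ i ≤ m, Z i w = z i} ∩ {w | Z (m + 1) w = y} =
      {w | ∀ i ≤ m + 1, Z i w = Function.update z (m + 1) y i} := by
    ext w
    constructor
    · rintro ⟨ha, hb⟩ i hi
      rcases Nat.le_succ_iff.1 hi with h | h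
      · rw [hz i h]
        exact ha i h
      · subst h
        simpa using hb
    · intro h
      refine ⟨fun i hi => ?_, ?_⟩
      · rw [← hz i hi]
        exact h i (by omega)
      · simpa using h (m + 1) le_rfl
  have h2 : {w | ∀ i ≤ m, Z i w = z i} =
      {w | ∀ i ≤ m, Z i w = Function.update z (m + 1) y i} := by
    ext w
    exact forall₂_congr fun i hi => by rw [hz i hi]
  rw [h1, h2, hZ.2, hZ.2, Finset.prod_range_succ, ← mul_assoc, Function.update_self,
    hz m le_rfl]
  simp [ratioKernel]

/-- A function of finitely many coordinates is a finite sum over paths, so integrability is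
automatic and expectations become finite sums. -/
theorem eq_sum_indicator_extendPath {X Ω : Type*} [Fintype X] [DecidableEq X] {Z : ℕ → Ω → X}
    {m : ℕ} {F : (ℕ → X) → ℝ} (hF : DependsOn F (Set.Iic m)) (ω : Ω) :
    F (fun i => Z i ω) = ∑ w : Fin (m + 1) → X,
      Set.indicator {ω | ∀ i ≤ m, Z i ω = extendPath m w i} (fun _ => F (extendPath m w)) ω := by
  rw [Finset.sum_eq_single (fun i : Fin (m + 1) => Z i ω)]
  · rw [Set.indicator_of_mem]
    · exact hF fun i hi => (extendPath_apply (fun i => Z i ω) hi).symm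
    · exact fun i hi => (extendPath_apply (fun i => Z i ω) hi).symm
  · intro w _ hw
    exact Set.indicator_of_notMem
      (fun h : ∀ i ≤ m, Z i ω = extendPath m w i => hw (extendPath_eq h)) _
  · simp

theorem IsTrajectory.integrable [IsProbabilityMeasure Pr] (hZ : IsTrajectory M πb Pr Z) {m : ℕ}
    {F : (ℕ → S × A) → ℝ} (hF : DependsOn F (Set.Iic m)) :
    Integrable (fun ω => F (fun i => Z i ω)) Pr := by
  classical
  simp only [eq_sum_indicator_extendPath hF]
  exact integrable_finsetSum _ fun w _ =>
    (integrable_const _).indicator (hZ.measurableSet_cylinder m _)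

theorem IsTrajectory.integral_eq_sum [IsProbabilityMeasure Pr] [DecidableEq (S × A)]
    (hZ : IsTrajectory M πb Pr Z) {m : ℕ}
    {F : (ℕ → S × A) → ℝ} (hF : DependsOn F (Set.Iic m)) :
    ∫ ω, F (fun i => Z i ω) ∂Pr = ∑ w : Fin (m + 1) → S × A,
      Pr.real {ω | ∀ i ≤ m, Z i ω = extendPath m w i} * F (extendPath m w) := by
  simp only [eq_sum_indicator_extendPath hF]
  rw [integral_finsetSum _ fun w _ =>
    (integrable_const _).indicator (hZ.measurableSet_cylinder m _)]
  exact Finset.sum_congr rfl fun w _ => by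
    rw [integral_indicator_const _ (hZ.measurableSet_cylinder m _), smul_eq_mul]

/-- The one-step Markov property. -/
theorem IsTrajectory.integral_succ [IsProbabilityMeasure Pr] (hZ : IsTrajectory M πb Pr Z) {m : ℕ}
    {Φ : (ℕ → S × A) → S × A → ℝ} (hΦ : DependsOn Φ (Set.Iic m)) :
    ∫ ω, Φ (fun i => Z i ω) (Z (m + 1) ω) ∂Pr =
      ∫ ω, (ratioKernel M πb (fun _ => 1)).mulVec (Φ fun i => Z i ω) (Z m ω) ∂Pr := by
  classical
  have hmeas : ∀ (w : Fin (m + 1) → S × A) (y : S × A),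
      MeasurableSet ({ω | ∀ i ≤ m, Z i ω = extendPath m w i} ∩ {ω | Z (m + 1) ω = y}) :=
    fun w y => (hZ.measurableSet_cylinder m _).inter (hZ.1 _ _)
  have h1 : ∀ ω, Φ (fun i => Z i ω) (Z (m + 1) ω) = ∑ w : Fin (m + 1) → S × A, ∑ y,
      Set.indicator ({ω | ∀ i ≤ m, Z i ω = extendPath m w i} ∩ {ω | Z (m + 1) ω = y})
        (fun _ => Φ (extendPath m w) y) ω := by
    intro ω
    rw [Finset.sum_eq_single (fun i : Fin (m + 1) => Z i ω)]
    · rw [Finset.sum_eq_single (Z (m + 1) ω)]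
      · rw [Set.indicator_of_mem]
        · rw [hΦ fun i hi => (extendPath_apply (fun i => Z i ω) hi).symm]
        · exact ⟨fun i hi => (extendPath_apply (fun i => Z i ω) hi).symm, rfl⟩
      · intro y _ hy
        exact Set.indicator_of_notMem (fun h => hy h.2.symm) _
      · simp
    · intro w _ hw
      exact Finset.sum_eq_zero fun y _ =>
        Set.indicator_of_notMem (fun h => hw (extendPath_eq h.1)) _
    · simp
  have h2 : DependsOn (fun z : ℕ → S × A => (ratioKernel M πb (fun _ => 1)).mulVec (Φ z) (z m))
      (Set.Iic m) := fun z z' h => by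
    simp only [hΦ h, h m (Set.mem_Iic.2 le_rfl)]
  have h3 := hZ.integral_eq_sum h2
  simp only at h3
  rw [h3]
  simp only [h1]
  rw [integral_finsetSum _ fun w _ => integrable_finsetSum _ fun y _ =>
    (integrable_const _).indicator (hmeas w y)]
  refine Finset.sum_congr rfl fun w _ => ?_
  rw [integral_finsetSum _ fun y _ => (integrable_const _).indicator (hmeas w y), Matrix.mulVec,
    dotProduct, Finset.mul_sum]
  refine Finset.sum_congr rfl fun y _ => ?_
  rw [integral_indicator_const _ (hmeas w y), smul_eq_mul, hZ.real_cylinder_inter, mul_assoc]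

theorem IsTrajectory.integral_iterate [DecidableEq S] [DecidableEq A] [IsProbabilityMeasure Pr]
    (hZ : IsTrajectory M πb Pr Z) {m : ℕ} (r : ℕ)
    {Φ : (ℕ → S × A) → S × A → ℝ} (hΦ : DependsOn Φ (Set.Iic m)) :
    ∫ ω, Φ (fun i => Z i ω) (Z (m + r) ω) ∂Pr =
      ∫ ω, (ratioKernel M πb (fun _ => 1) ^ r).mulVec (Φ fun i => Z i ω) (Z m ω) ∂Pr := by
  induction r generalizing Φ with
  | zero => simp
  | succ r ih =>
    have h1 : DependsOn Φ (Set.Iic (m + r)) := fun z z' h =>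
      hΦ fun i hi => h i (Set.mem_Iic.2 ((Set.mem_Iic.1 hi).trans (Nat.le_add_right _ _)))
    have h2 : DependsOn (fun z => (ratioKernel M πb (fun _ => 1)).mulVec (Φ z)) (Set.Iic m) :=
      fun z z' h => by simp only [hΦ h]
    rw [← Nat.add_assoc, hZ.integral_succ h1, ih h2]
    simp only [Matrix.mulVec_mulVec, pow_succ]

theorem ratioKernel_one_mulVec_mul (M : MDP S A) (πb : Policy S A) (b : ℝ) (c g : S × A → ℝ)
    (x : S × A) :
    (ratioKernel M πb (fun _ => 1)).mulVec (fun y => b * c y * g y) x =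
      b * (ratioKernel M πb c).mulVec g x := by
  simp only [Matrix.mulVec, dotProduct, Finset.mul_sum, ratioKernel, Matrix.of_apply]
  exact Finset.sum_congr rfl fun y _ => by ring

theorem prod_Icc_congr {X : Type*} {c : X → ℝ} {k i : ℕ} {z z' : ℕ → X}
    (h : ∀ j ∈ Set.Iic (k + i), z j = z' j) :
    ∏ j ∈ Finset.Icc (k + 1) (k + i), c (z j) = ∏ j ∈ Finset.Icc (k + 1) (k + i), c (z' j) :=
  Finset.prod_congr rfl fun j hj => by rw [h j (Set.mem_Iic.2 (Finset.mem_Icc.1 hj).2)]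

/-- Change of kernel: integrating out the last step absorbs its ratio and turns the plain kernel
into the one weighted by `c`; induction removes the ratios from the last to the first. -/
theorem IsTrajectory.integral_prod_mul [DecidableEq S] [DecidableEq A] [IsProbabilityMeasure Pr]
    (hZ : IsTrajectory M πb Pr Z) (c : S × A → ℝ) {k : ℕ} (i : ℕ) {φ : (ℕ → S × A) → ℝ}
    (hφ : DependsOn φ (Set.Iic k))
    {g : (ℕ → S × A) → S × A → ℝ} (hg : DependsOn g (Set.Iic k)) :
    ∫ ω, φ (fun i => Z i ω) * (∏ j ∈ Finset.Icc (k + 1) (k + i), c (Z j ω)) *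
        g (fun i => Z i ω) (Z (k + i) ω) ∂Pr =
      ∫ ω, φ (fun i => Z i ω) *
        (ratioKernel M πb c ^ i).mulVec (g fun i => Z i ω) (Z k ω) ∂Pr := by
  induction i generalizing g with
  | zero => simp
  | succ i ih =>
    have h1 : DependsOn (fun z y => φ z * (∏ j ∈ Finset.Icc (k + 1) (k + i), c (z j)) * c y *
        g z y) (Set.Iic (k + i)) := fun z z' h => by
      have h' : ∀ j ∈ Set.Iic k, z j = z' j := fun j hj =>
        h j (Set.mem_Iic.2 ((Set.mem_Iic.1 hj).trans (Nat.le_add_right _ _)))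
      simp only [hφ h', hg h', prod_Icc_congr h]
    have h2 : DependsOn (fun z => (ratioKernel M πb c).mulVec (g z)) (Set.Iic k) :=
      fun z z' h => by simp only [hg h]
    have h3 := hZ.integral_succ h1
    simp only [ratioKernel_one_mulVec_mul] at h3
    have h4 := ih h2
    simp only [Matrix.mulVec_mulVec, ← pow_succ] at h4
    rw [← h4, ← h3]
    refine integral_congr_ae (Filter.Eventually.of_forall fun ω => ?_)
    simp only [← Nat.add_assoc]
    rw [Finset.prod_Icc_succ_top (by omega)]
    ring

/-- The scalar increment of the algorithm at time `k`. -/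
def tdInc (M : MDP S A) (n : ℕ) (c ρ q : S × A → ℝ) (z : ℕ → S × A) (k : ℕ) : ℝ :=
  ∑ i ∈ Finset.range n, M.disc ^ i * ((∏ j ∈ Finset.Icc (k + 1) (k + i), c (z j)) *
    tdError M ρ q (z (k + i)) (z (k + i + 1)))

theorem tdInc_congr {S A : Type*} [Fintype S] {M : MDP S A} {n k : ℕ} (c ρ q : S × A → ℝ)
    {z z' : ℕ → S × A}
    (h : ∀ j ≤ k + n, z j = z' j) : tdInc M n c ρ q z k = tdInc M n c ρ q z' k := by
  refine Finset.sum_congr rfl fun i hi => ?_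
  have hi' := Finset.mem_range.1 hi
  rw [h (k + i) (by omega), h (k + i + 1) (by omega),
    prod_Icc_congr fun j hj => h j ((Set.mem_Iic.1 hj).trans (by omega))]

/-- Expected increment along a direction determined by the past. -/
theorem IsTrajectory.integral_tdInc [DecidableEq S] [DecidableEq A] [IsProbabilityMeasure Pr]
    (hZ : IsTrajectory M πb Pr Z) (n : ℕ) (c ρ : S × A → ℝ) {m : ℕ} (r : ℕ)
    {u q : (ℕ → S × A) → S × A → ℝ} (hu : DependsOn u (Set.Iic m)) (hq : DependsOn q (Set.Iic m)) :
    ∫ ω, u (fun i => Z i ω) (Z (m + r) ω) *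
        tdInc M n c ρ (q fun i => Z i ω) (fun i => Z i ω) (m + r) ∂Pr =
      ∫ ω, (ratioKernel M πb (fun _ => 1) ^ r).mulVec (fun x => u (fun i => Z i ω) x *
        (traceSum M πb n c).mulVec (tdMean M πb ρ (q fun i => Z i ω)) x) (Z m ω) ∂Pr := by
  set k := m + r with hk
  have hmono : ∀ {a : ℕ} {z z' : ℕ → S × A}, m ≤ a → (∀ j ∈ Set.Iic a, z j = z' j) →
      ∀ j ∈ Set.Iic m, z j = z' j := fun ha h j hj =>
    h j (Set.mem_Iic.2 ((Set.mem_Iic.1 hj).trans ha))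
  have hφ : DependsOn (fun z : ℕ → S × A => u z (z k)) (Set.Iic k) := fun z z' h => by
    simp only [hu (hmono (Nat.le_add_right _ _) h), h k (Set.mem_Iic.2 le_rfl)]
  have hδ : DependsOn (fun z => tdMean M πb ρ (q z)) (Set.Iic k) := fun z z' h => by
    simp only [hq (hmono (Nat.le_add_right _ _) h)]
  have h1 : DependsOn (fun z x => u z x * (traceSum M πb n c).mulVec (tdMean M πb ρ (q z)) x)
      (Set.Iic m) := fun z z' h => by simp only [hu h, hq h]
  -- Undoing the `r` plain steps moves the right side to time `k`; both sides then split into `n`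
  -- summands, compared one `i` at a time.
  rw [← hZ.integral_iterate r h1]
  simp only [tdInc, traceSum_mulVec, Finset.mul_sum]
  have hdep : ∀ i, DependsOn (fun z : ℕ → S × A => u z (z k) * (M.disc ^ i *
      ((∏ j ∈ Finset.Icc (k + 1) (k + i), c (z j)) *
        tdError M ρ (q z) (z (k + i)) (z (k + i + 1))))) (Set.Iic (k + i + 1)) := by
    intro i z z' h
    have h' : ∀ j ∈ Set.Iic (k + i), z j = z' j := fun j hj =>
      h j (Set.mem_Iic.2 ((Set.mem_Iic.1 hj).trans (Nat.le_succ _)))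
    simp only [hu (hmono (by omega) h), hq (hmono (by omega) h), h k (Set.mem_Iic.2 (by omega)),
      prod_Icc_congr h', h (k + i) (Set.mem_Iic.2 (by omega)),
      h (k + i + 1) (Set.mem_Iic.2 (by omega))]
  have hdep' : ∀ i, DependsOn (fun z : ℕ → S × A => u z (z k) * (M.disc ^ i *
      (ratioKernel M πb c ^ i).mulVec (tdMean M πb ρ (q z)) (z k))) (Set.Iic k) := by
    intro i z z' h
    simp only [hu (hmono (Nat.le_add_right _ _) h), hq (hmono (Nat.le_add_right _ _) h),
      h k (Set.mem_Iic.2 le_rfl)]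
  rw [integral_finsetSum _ fun i _ => hZ.integrable (hdep i),
    integral_finsetSum _ fun i _ => hZ.integrable (hdep' i)]
  refine Finset.sum_congr rfl fun i _ => ?_
  have h2 : DependsOn (fun z y => u z (z k) * (∏ j ∈ Finset.Icc (k + 1) (k + i), c (z j)) *
      tdError M ρ (q z) (z (k + i)) y) (Set.Iic (k + i)) := fun z z' h => by
    simp only [hu (hmono (by omega) h), hq (hmono (by omega) h), h k (Set.mem_Iic.2 (by omega)),
      prod_Icc_congr h, h (k + i) (Set.mem_Iic.2 le_rfl)]
  -- Conditioning on the path up to `k + i` replaces the temporal difference by its mean; `h7` below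
  -- then integrates out the ratios.
  have h3 := hZ.integral_succ h2
  have h4 : ∀ (b : ℝ) (q : S × A → ℝ) (x : S × A),
      (ratioKernel M πb (fun _ => 1)).mulVec (fun y => b * tdError M ρ q x y) x =
        b * tdMean M πb ρ q x := by
    intro b q x
    have h5 := ratioKernel_one_mulVec_mul M πb (b * M.disc) ρ q x
    have h6 : (fun y => b * tdError M ρ q x y) =
        (fun y => b * M.disc * ρ y * q y) + fun _ => b * (M.reward x - q x) := by
      ext y
      simp only [tdError, Pi.add_apply]
      ring
    rw [h6, Matrix.mulVec_add, Pi.add_apply, h5, tdMean]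
    simp only [Matrix.mulVec, dotProduct]
    rw [← Finset.sum_mul, ratioKernel_one_row_sum]
    ring
  simp only [h4] at h3
  have h7 := hZ.integral_prod_mul c i hφ hδ
  simp only at h7
  rw [h7] at h3
  have h8 : ∀ a b d : ℝ, a * (M.disc ^ i * (b * d)) = M.disc ^ i * (a * b * d) := by
    intros; ring
  have h9 : ∀ a b : ℝ, a * (M.disc ^ i * b) = M.disc ^ i * (a * b) := by
    intros; ring
  simp only [h8, h9, integral_const_mul, h3]

end Trajectory

/-! ### Pathwise bounds on the iterates and bias of the Markovian noise. -/

section Iteration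

open MeasureTheory

variable {S A : Type*} [Fintype S]

/-- The increment direction of the algorithm at time `k`. -/
def incVec [DecidableEq S] [DecidableEq A] (M : MDP S A) (n : ℕ) (c ρ q : S × A → ℝ)
    (z : ℕ → S × A) (k : ℕ) : S × A → ℝ :=
  fun x => if x = z k then tdInc M n c ρ q z k else 0

theorem tdIterate_succ [DecidableEq S] [DecidableEq A] (M : MDP S A) (n : ℕ) (c ρ : S × A → ℝ)
    (α : ℝ) (Q₀ : S × A → ℝ) (z : ℕ → S × A) (k : ℕ) :
    tdIterate M n c ρ α Q₀ z (k + 1) = tdIterate M n c ρ α Q₀ z k +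
      α • incVec M n c ρ (tdIterate M n c ρ α Q₀ z k) z k := by
  ext x
  simp only [tdIterate, incVec, tdInc, Pi.add_apply, Pi.smul_apply, smul_eq_mul,
    Finset.sum_Ico_eq_sum_range, Nat.add_sub_cancel_left, mul_assoc, ite_mul, zero_mul, mul_ite,
    mul_zero]

/-- The update producing iterate `k + 1` looks ahead to coordinate `k + n`, so iterate `k` reads
only coordinates below `k + n`. This lookahead is why `n` appears in the delay. -/
theorem tdIterate_congr [DecidableEq S] [DecidableEq A] (M : MDP S A) (n : ℕ) (c ρ : S × A → ℝ)
    (α : ℝ) (Q₀ : S × A → ℝ) {z z' : ℕ → S × A} {k : ℕ} (h : ∀ i < k + n, z i = z' i) :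
    tdIterate M n c ρ α Q₀ z k = tdIterate M n c ρ α Q₀ z' k := by
  induction k with
  | zero => rfl
  | succ k ih =>
    rw [tdIterate_succ, tdIterate_succ, ih fun i hi => h i (by omega)]
    have h1 : tdInc M n c ρ (tdIterate M n c ρ α Q₀ z' k) z k =
        tdInc M n c ρ (tdIterate M n c ρ α Q₀ z' k) z' k :=
      tdInc_congr c ρ _ fun j hj => h j (by omega)
    ext x
    simp only [Pi.add_apply, Pi.smul_apply, incVec, h1, h k (by omega)]

variable [Fintype A]

theorem abs_sum_disc_prod_mul_le (M : MDP S A) (n : ℕ) {c : S × A → ℝ} (hc : ∀ x, 0 ≤ c x)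
    (z : ℕ → S × A) (k : ℕ) {g : ℕ → ℝ} {r : ℝ} (hg : ∀ i, |g i| ≤ r) :
    |∑ i ∈ Finset.range n, M.disc ^ i * ((∏ j ∈ Finset.Icc (k + 1) (k + i), c (z j)) * g i)| ≤
      geomF n (M.disc * ⨆ x, c x) * r := by
  rw [geomF_eq_sum, Finset.sum_mul]
  refine (Finset.abs_sum_le_sum_abs _ _).trans (Finset.sum_le_sum fun i _ => ?_)
  have hprod : 0 ≤ ∏ j ∈ Finset.Icc (k + 1) (k + i), c (z j) :=
    Finset.prod_nonneg fun j _ => hc _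
  have hprod' : ∏ j ∈ Finset.Icc (k + 1) (k + i), c (z j) ≤ (⨆ x, c x) ^ i := by
    calc ∏ j ∈ Finset.Icc (k + 1) (k + i), c (z j)
        ≤ ∏ _j ∈ Finset.Icc (k + 1) (k + i), ⨆ x, c x :=
          Finset.prod_le_prod (fun j _ => hc _)
            fun j _ => le_ciSup (Set.finite_range _).bddAbove (z j)
      _ = (⨆ x, c x) ^ i := by
        rw [Finset.prod_const, Nat.card_Icc]
        congr 1
        omega
  rw [abs_mul, abs_mul, abs_of_nonneg hprod, abs_of_nonneg (pow_nonneg M.disc_pos.le i), mul_pow,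
    mul_assoc]
  exact mul_le_mul_of_nonneg_left (mul_le_mul hprod' (hg i) (abs_nonneg _) (hprod.trans hprod'))
    (pow_nonneg M.disc_pos.le i)

theorem abs_tdError_sub_le (M : MDP S A) {ρ : S × A → ℝ} (hρ : ∀ x, 0 ≤ ρ x)
    {q q' : S × A → ℝ} {r : ℝ} (h : ∀ x, |(q - q') x| ≤ r) (x y : S × A) :
    |tdError M ρ q x y - tdError M ρ q' x y| ≤ (M.disc * (⨆ x, ρ x) + 1) * r := by
  have h1 : tdError M ρ q x y - tdError M ρ q' x y =
      M.disc * (ρ y * (q - q') y) - (q - q') x := by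
    simp only [tdError, Pi.sub_apply]
    ring
  rw [h1]
  refine (abs_sub _ _).trans ?_
  rw [abs_mul, abs_mul, abs_of_pos M.disc_pos, abs_of_nonneg (hρ y), add_mul, one_mul, mul_assoc]
  have h2 : ρ y ≤ ⨆ x, ρ x := le_ciSup (Set.finite_range _).bddAbove y
  exact add_le_add (mul_le_mul_of_nonneg_left (mul_le_mul h2 (h y) (abs_nonneg _)
    ((hρ y).trans h2)) M.disc_pos.le) (h x)

theorem abs_tdError_le (M : MDP S A) {ρ : S × A → ℝ} (hρ : ∀ x, 0 ≤ ρ x)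
    {q : S × A → ℝ} {r : ℝ} (h : ∀ x, |q x| ≤ r) (x y : S × A) :
    |tdError M ρ q x y| ≤ 1 + (M.disc * (⨆ x, ρ x) + 1) * r := by
  have h1 := abs_tdError_sub_le M hρ (q := q) (q' := 0) (by simpa using h) x y
  have h2 : tdError M ρ q x y = M.reward x + (tdError M ρ q x y - tdError M ρ 0 x y) := by
    simp [tdError]
  rw [h2]
  refine (abs_add_le _ _).trans (add_le_add ?_ h1)
  rw [abs_of_nonneg (M.reward_nonneg x)]
  exact M.reward_le_one x

theorem abs_tdInc_le (M : MDP S A) (n : ℕ) {c ρ : S × A → ℝ} (hc : ∀ x, 0 ≤ c x)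
    (hρ : ∀ x, 0 ≤ ρ x) {q : S × A → ℝ} {r : ℝ} (h : ∀ x, |q x| ≤ r) (z : ℕ → S × A) (k : ℕ) :
    |tdInc M n c ρ q z k| ≤
      geomF n (M.disc * ⨆ x, c x) * (1 + (M.disc * (⨆ x, ρ x) + 1) * r) :=
  abs_sum_disc_prod_mul_le M n hc z k fun _ => abs_tdError_le M hρ h _ _

theorem abs_tdInc_sub_le (M : MDP S A) (n : ℕ) {c ρ : S × A → ℝ} (hc : ∀ x, 0 ≤ c x)
    (hρ : ∀ x, 0 ≤ ρ x) {q q' : S × A → ℝ} {r : ℝ} (h : ∀ x, |(q - q') x| ≤ r)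
    (z : ℕ → S × A) (k : ℕ) :
    |tdInc M n c ρ q z k - tdInc M n c ρ q' z k| ≤
      geomF n (M.disc * ⨆ x, c x) * ((M.disc * (⨆ x, ρ x) + 1) * r) := by
  have h1 := abs_sum_disc_prod_mul_le M n hc z k
    (g := fun i => tdError M ρ q (z (k + i)) (z (k + i + 1)) -
      tdError M ρ q' (z (k + i)) (z (k + i + 1)))
    (fun i => abs_tdError_sub_le M hρ h _ _)
  simpa only [mul_sub, Finset.sum_sub_distrib, tdInc] using h1

/-- Lipschitz constant of the increments with respect to the weighted norm. -/
noncomputable def lipConst (M : MDP S A) (n : ℕ) (c ρ μ : S × A → ℝ) (p : ℝ) : ℝ :=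
  geomF n (M.disc * ⨆ x, c x) * (M.disc * (⨆ x, ρ x) + 1) / (⨅ x, μ x) ^ (1 / p)

section Bounds

variable {M : MDP S A} {n : ℕ} {c ρ μ : S × A → ℝ} {p : ℝ}

theorem iInf_weight_pos [Nonempty S] [Nonempty A] (hμ : ∀ x, 0 < μ x) : 0 < ⨅ x, μ x := by
  obtain ⟨x, hx⟩ := exists_eq_ciInf_of_finite (f := μ)
  rw [← hx]
  exact hμ x

theorem iInf_weight_le_one [Nonempty S] [Nonempty A] (hμ : ∀ x, 0 < μ x) (hμ1 : ∑ x, μ x = 1) :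
    ⨅ x, μ x ≤ 1 := by
  obtain ⟨x⟩ : Nonempty (S × A) := inferInstance
  rw [← hμ1]
  exact (ciInf_le (Set.finite_range _).bddBelow x).trans
    (Finset.single_le_sum (fun y _ => (hμ y).le) (Finset.mem_univ x))

theorem abs_le_wNorm_div [Nonempty S] [Nonempty A] (hμ : ∀ x, 0 < μ x) (hp : 2 ≤ p)
    (q : S × A → ℝ) (x : S × A) : |q x| ≤ wNorm μ p q / (⨅ x, μ x) ^ (1 / p) := by
  have hm := iInf_weight_pos hμ
  rw [le_div_iff₀ (Real.rpow_pos_of_pos hm _), mul_comm]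
  refine le_trans (mul_le_mul_of_nonneg_right ?_ (abs_nonneg _)) (rpow_mul_abs_le_wNorm hμ hp q x)
  exact Real.rpow_le_rpow hm.le (ciInf_le (Set.finite_range _).bddBelow x)
    (div_nonneg zero_le_one (by linarith))

theorem one_le_disc_mul_iSup_add {S A : Type*} [Fintype S] {M : MDP S A} {ρ : S × A → ℝ}
    (hρ : ∀ x, 0 ≤ ρ x) : 1 ≤ M.disc * (⨆ x, ρ x) + 1 := by
  have := mul_nonneg M.disc_pos.le (Real.iSup_nonneg hρ)
  linarith

theorem geomF_le_lipConst [Nonempty S] [Nonempty A] (hn : 1 ≤ n) (hc : ∀ x, 0 ≤ c x)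
    (hρ : ∀ x, 0 ≤ ρ x) (hμ : ∀ x, 0 < μ x) (hμ1 : ∑ x, μ x = 1) (hp : 2 ≤ p) :
    geomF n (M.disc * ⨆ x, c x) ≤ lipConst M n c ρ μ p := by
  have hf := one_le_geomF hn (mul_nonneg M.disc_pos.le (Real.iSup_nonneg hc))
  have hm := Real.rpow_pos_of_pos (iInf_weight_pos hμ) (1 / p)
  have hm1 : (⨅ x, μ x) ^ (1 / p) ≤ 1 := Real.rpow_le_one (iInf_weight_pos hμ).le
    (iInf_weight_le_one hμ hμ1) (div_nonneg zero_le_one (by linarith))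
  rw [lipConst, le_div_iff₀ hm]
  refine mul_le_mul_of_nonneg_left ?_ (by linarith)
  exact hm1.trans (one_le_disc_mul_iSup_add hρ)

theorem one_le_lipConst [Nonempty S] [Nonempty A] (hn : 1 ≤ n) (hc : ∀ x, 0 ≤ c x)
    (hρ : ∀ x, 0 ≤ ρ x) (hμ : ∀ x, 0 < μ x) (hμ1 : ∑ x, μ x = 1) (hp : 2 ≤ p) :
    1 ≤ lipConst M n c ρ μ p :=
  (one_le_geomF hn (mul_nonneg M.disc_pos.le (Real.iSup_nonneg hc))).trans
    (geomF_le_lipConst hn hc hρ hμ hμ1 hp)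

/-- The sup norm is at most `μ_min ^ (-1/p)` times the weighted norm; squared, this is the source of
`μ_min ^ (2/p)` in the stepsize condition. -/
theorem lipConst_sq [Nonempty S] [Nonempty A] (hμ : ∀ x, 0 < μ x) :
    lipConst M n c ρ μ p ^ 2 = varFactor M n c ρ / (⨅ x, μ x) ^ (2 / p) := by
  have h1 : (⨅ x, μ x) ^ (2 / p) = ((⨅ x, μ x) ^ (1 / p)) ^ 2 := by
    rw [← Real.rpow_natCast, ← Real.rpow_mul (iInf_weight_pos hμ).le]
    congr 1
    push_cast
    ring
  rw [lipConst, varFactor, h1]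
  ring

theorem growth_le_lipConst [Nonempty S] [Nonempty A] (hn : 1 ≤ n) (hc : ∀ x, 0 ≤ c x)
    (hρ : ∀ x, 0 ≤ ρ x) (hμ : ∀ x, 0 < μ x) (hμ1 : ∑ x, μ x = 1) (hp : 2 ≤ p) (r : ℝ) :
    geomF n (M.disc * ⨆ x, c x) *
        (1 + (M.disc * (⨆ x, ρ x) + 1) * (r / (⨅ x, μ x) ^ (1 / p))) ≤
      lipConst M n c ρ μ p * (r + 1) := by
  have := geomF_le_lipConst (M := M) hn hc hρ hμ hμ1 hp
  have h1 : geomF n (M.disc * ⨆ x, c x) *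
      (1 + (M.disc * (⨆ x, ρ x) + 1) * (r / (⨅ x, μ x) ^ (1 / p))) =
      geomF n (M.disc * ⨆ x, c x) + lipConst M n c ρ μ p * r := by
    rw [lipConst]
    ring
  linarith

variable [DecidableEq S] [DecidableEq A]

theorem wNorm_incVec_le [Nonempty S] [Nonempty A] (hn : 1 ≤ n) (hc : ∀ x, 0 ≤ c x)
    (hρ : ∀ x, 0 ≤ ρ x) (hμ : ∀ x, 0 < μ x) (hμ1 : ∑ x, μ x = 1) (hp : 2 ≤ p)
    (q : S × A → ℝ) (z : ℕ → S × A) (k : ℕ) :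
    wNorm μ p (incVec M n c ρ q z k) ≤ lipConst M n c ρ μ p * (wNorm μ p q + 1) := by
  have h1 := (abs_tdInc_le M n hc hρ (abs_le_wNorm_div hμ hp q) z k).trans
    (growth_le_lipConst hn hc hρ hμ hμ1 hp _)
  have h0 := (abs_nonneg _).trans h1
  refine wNorm_le_of_abs_le hμ hμ1 hp h0 fun x => ?_
  unfold incVec
  split_ifs
  · exact h1
  · simpa using h0

theorem wNorm_incVec_sub_le [Nonempty S] [Nonempty A] (hc : ∀ x, 0 ≤ c x)
    (hρ : ∀ x, 0 ≤ ρ x) (hμ : ∀ x, 0 < μ x) (hμ1 : ∑ x, μ x = 1) (hp : 2 ≤ p)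
    (q q' : S × A → ℝ) (z : ℕ → S × A) (k : ℕ) :
    wNorm μ p (incVec M n c ρ q z k - incVec M n c ρ q' z k) ≤
      lipConst M n c ρ μ p * wNorm μ p (q - q') := by
  have h1 := abs_tdInc_sub_le M n hc hρ (abs_le_wNorm_div hμ hp (q - q')) z k
  have h2 : geomF n (M.disc * ⨆ x, c x) * ((M.disc * (⨆ x, ρ x) + 1) *
      (wNorm μ p (q - q') / (⨅ x, μ x) ^ (1 / p))) =
      lipConst M n c ρ μ p * wNorm μ p (q - q') := by
    rw [lipConst]
    ring
  rw [h2] at h1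
  have h0 := (abs_nonneg _).trans h1
  refine wNorm_le_of_abs_le hμ hμ1 hp h0 fun x => ?_
  unfold incVec
  rw [Pi.sub_apply]
  split_ifs
  · exact h1
  · simpa using h0

variable (πb : Policy S A)

theorem abs_traceSum_tdMean_le [Nonempty S] [Nonempty A] (hn : 1 ≤ n) (hc : ∀ x, 0 ≤ c x)
    (hρ : ∀ x, 0 ≤ ρ x) (hμ : ∀ x, 0 < μ x) (hμ1 : ∑ x, μ x = 1) (hp : 2 ≤ p)
    (q : S × A → ℝ) (x : S × A) :
    |(traceSum M πb n c).mulVec (tdMean M πb ρ q) x| ≤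
      lipConst M n c ρ μ p * (wNorm μ p q + 1) :=
  (abs_traceSum_mulVec_le M πb n hc (abs_tdMean_le M πb hρ (abs_le_wNorm_div hμ hp q)) x).trans
    (growth_le_lipConst hn hc hρ hμ hμ1 hp _)

theorem wNorm_meanInc_le [Nonempty S] [Nonempty A] (hn : 1 ≤ n) (hc : ∀ x, 0 ≤ c x)
    (hρ : ∀ x, 0 ≤ ρ x) (hμ : ∀ x, 0 < μ x) (hμ1 : ∑ x, μ x = 1) (hp : 2 ≤ p)
    (q : S × A → ℝ) :
    wNorm μ p (meanInc M πb n c ρ q) ≤ lipConst M n c ρ μ p * (wNorm μ p q + 1) := by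
  have h1 := abs_traceSum_tdMean_le (M := M) πb hn hc hρ hμ hμ1 hp q
  obtain ⟨x₀⟩ : Nonempty (S × A) := inferInstance
  refine wNorm_le_of_abs_le hμ hμ1 hp ((abs_nonneg _).trans (h1 x₀)) fun x => ?_
  unfold meanInc
  rw [abs_mul, abs_of_nonneg (stationarySA_nonneg M πb x)]
  exact (mul_le_of_le_one_left (abs_nonneg _) (stationarySA_le_one M πb x)).trans (h1 x)

theorem wNorm_meanInc_sub_le [Nonempty S] [Nonempty A] (hc : ∀ x, 0 ≤ c x)
    (hρ : ∀ x, 0 ≤ ρ x) (hμ : ∀ x, 0 < μ x) (hμ1 : ∑ x, μ x = 1) (hp : 2 ≤ p)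
    (q q' : S × A → ℝ) :
    wNorm μ p (meanInc M πb n c ρ q - meanInc M πb n c ρ q') ≤
      lipConst M n c ρ μ p * wNorm μ p (q - q') := by
  have h1 := abs_traceSum_mulVec_le M πb n hc
    (abs_tdMean_sub_le M πb hρ (abs_le_wNorm_div hμ hp (q - q')))
  have h2 : geomF n (M.disc * ⨆ x, c x) * ((M.disc * (⨆ x, ρ x) + 1) *
      (wNorm μ p (q - q') / (⨅ x, μ x) ^ (1 / p))) =
      lipConst M n c ρ μ p * wNorm μ p (q - q') := by
    rw [lipConst]
    ring
  rw [h2] at h1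
  obtain ⟨x₀⟩ : Nonempty (S × A) := inferInstance
  refine wNorm_le_of_abs_le hμ hμ1 hp ((abs_nonneg _).trans (h1 x₀)) fun x => ?_
  unfold meanInc
  rw [Pi.sub_apply, ← mul_sub, ← Pi.sub_apply, ← Matrix.mulVec_sub, abs_mul,
    abs_of_nonneg (stationarySA_nonneg M πb x)]
  exact (mul_le_of_le_one_left (abs_nonneg _) (stationarySA_le_one M πb x)).trans (h1 x)

end Bounds

theorem abs_wGrad_le {X : Type*} [Fintype X] {μ : X → ℝ} (hμ : ∀ i, 0 < μ i) (hμ1 : ∑ i, μ i = 1)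
    {p : ℝ} (hp : 2 ≤ p) (v : X → ℝ) (i : X) : |wGrad μ p v i| ≤ wNorm μ p v := by
  classical
  have h1 := abs_wGrad_pair_le hμ hp v (Pi.single i 1)
  have h2 : wNorm μ p (Pi.single i 1) ≤ 1 := wNorm_le_of_abs_le hμ hμ1 hp zero_le_one fun j => by
    rcases eq_or_ne j i with rfl | h
    · simp
    · simp [h]
  simp only [Pi.single_apply, mul_ite, mul_one, mul_zero, Finset.sum_ite_eq', Finset.mem_univ,
    if_true] at h1
  exact h1.trans (mul_le_of_le_one_right (wNorm_nonneg hμ _ _) h2)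

/-- One-step drift of the squared norm, with the noise evaluated at a delayed iterate. -/
theorem wNorm_sq_drift {X : Type*} [Fintype X] {μ : X → ℝ} (hμ : ∀ i, 0 < μ i)
    {p : ℝ} (hp : 2 ≤ p) {v u h h₀ g g₀ : X → ℝ} {L x y α a b κ : ℝ}
    (hg : ∑ i, wGrad μ p v i * g i ≤ -κ * wNorm μ p v ^ 2)
    (hvu : wNorm μ p (v - u) ≤ 3 * x * a) (hu : wNorm μ p u ≤ 2 * b)
    (hh1 : wNorm μ p h ≤ L * a) (hg1 : wNorm μ p g ≤ L * a)
    (hh0 : wNorm μ p (h - h₀) ≤ L * wNorm μ p (v - u))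
    (hg0 : wNorm μ p (g - g₀) ≤ L * wNorm μ p (v - u))
    (ha : 0 ≤ a) (hab : a ≤ b) (hL : 1 ≤ L) (hxy : x ≤ L * y) (hα : 0 < α)
    (hαy : α ≤ y) :
    wNorm μ p (v + α • h) ^ 2 ≤ (1 - 2 * α * κ) * wNorm μ p v ^ 2 +
      2 * α * ((21 * p + 12) * (L ^ 2 * y * b ^ 2)) +
      2 * α * ∑ i, wGrad μ p u i * (h₀ i - g₀ i) := by
  have hN := wNorm_nonneg hμ p
  have hL0 : 0 ≤ L := by linarith
  have hb : 0 ≤ b := ha.trans hab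
  have hy : 0 ≤ y := hα.le.trans hαy
  have hsm := wNorm_add_sq_le hμ hp v (α • h)
  rw [wNorm_smul hμ hp hα.le] at hsm
  have e1 : ∑ i, wGrad μ p v i * (α • h) i = α * ∑ i, wGrad μ p v i * h i := by
    rw [Finset.mul_sum]
    exact Finset.sum_congr rfl fun i _ => by simp only [Pi.smul_apply, smul_eq_mul]; ring
  -- Four parts: mean drift, change of gradient, change of noise between the two iterates, and noise
  -- at the delayed iterate, the only one that needs expectation. The second costs `3p·3·2 = 18p`
  -- and the third `2·2·3 = 12`; with `3p` from the quadratic term this makes `21p + 12`.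
  have e2 : ∑ i, wGrad μ p v i * h i = ∑ i, wGrad μ p v i * g i +
      ∑ i, (wGrad μ p v i - wGrad μ p u i) * (h - g) i +
      ∑ i, wGrad μ p u i * ((h - h₀) - (g - g₀)) i + ∑ i, wGrad μ p u i * (h₀ i - g₀ i) := by
    rw [← Finset.sum_add_distrib, ← Finset.sum_add_distrib, ← Finset.sum_add_distrib]
    exact Finset.sum_congr rfl fun i _ => by simp only [Pi.sub_apply]; ring
  have b1 := (le_abs_self _).trans (abs_wGrad_sub_pair_le hμ hp u v (h - g))
  have b2 := (le_abs_self _).trans (abs_wGrad_pair_le hμ hp u ((h - h₀) - (g - g₀)))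
  have n1 : wNorm μ p (h - g) ≤ 2 * L * a := by linarith [wNorm_sub_le hμ hp h g]
  have n2 : wNorm μ p ((h - h₀) - (g - g₀)) ≤ 2 * L * (3 * x * a) := by
    have := wNorm_sub_le hμ hp (h - h₀) (g - g₀)
    have := mul_le_mul_of_nonneg_left hvu hL0
    linarith
  have hxab : x * a ≤ L * y * b := mul_le_mul hxy hab ha (by positivity)
  have c1 : ∑ i, (wGrad μ p v i - wGrad μ p u i) * (h - g) i ≤
      18 * p * (L ^ 2 * y * b ^ 2) := by
    refine b1.trans ?_
    calc 3 * p * wNorm μ p (v - u) * wNorm μ p (h - g)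
        ≤ 3 * p * (3 * (L * y * b)) * (2 * L * b) := by
          refine mul_le_mul (mul_le_mul_of_nonneg_left (hvu.trans ?_) (by linarith))
            (n1.trans ?_) (hN _) (by positivity)
          · linarith
          · exact mul_le_mul_of_nonneg_left hab (by positivity)
      _ = _ := by ring
  have c2 : ∑ i, wGrad μ p u i * ((h - h₀) - (g - g₀)) i ≤ 12 * (L ^ 2 * y * b ^ 2) := by
    refine b2.trans ?_
    calc wNorm μ p u * wNorm μ p ((h - h₀) - (g - g₀))
        ≤ (2 * b) * (2 * L * (3 * (L * y * b))) := by
          refine mul_le_mul hu (n2.trans ?_) (hN _) (by positivity)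
          exact mul_le_mul_of_nonneg_left (by linarith) (by positivity)
      _ = _ := by ring
  have c3 : 6 * p * (α * wNorm μ p h) ^ 2 ≤ 2 * α * (3 * p * (L ^ 2 * y * b ^ 2)) := by
    have h1 : wNorm μ p h ≤ L * b := hh1.trans (mul_le_mul_of_nonneg_left hab hL0)
    have h2 : wNorm μ p h ^ 2 ≤ (L * b) ^ 2 := pow_le_pow_left₀ (hN h) h1 2
    calc 6 * p * (α * wNorm μ p h) ^ 2 = 6 * p * α * (α * wNorm μ p h ^ 2) := by ring
      _ ≤ 6 * p * α * (y * (L * b) ^ 2) := by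
        refine mul_le_mul_of_nonneg_left (mul_le_mul hαy h2 (sq_nonneg _) hy) (by positivity)
      _ = _ := by ring
  rw [e1, e2] at hsm
  have c4 : α * (∑ i, wGrad μ p v i * g i +
      ∑ i, (wGrad μ p v i - wGrad μ p u i) * (h - g) i +
      ∑ i, wGrad μ p u i * ((h - h₀) - (g - g₀)) i + ∑ i, wGrad μ p u i * (h₀ i - g₀ i)) ≤
      α * (-κ * wNorm μ p v ^ 2 + 18 * p * (L ^ 2 * y * b ^ 2) + 12 * (L ^ 2 * y * b ^ 2) +
        ∑ i, wGrad μ p u i * (h₀ i - g₀ i)) :=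
    mul_le_mul_of_nonneg_left (by linarith) hα.le
  linarith

/-- Slow variation of a sequence with increments of controlled relative size. -/
theorem wNorm_sub_le_of_increments {X : Type*} [Fintype X] {μ : X → ℝ} (hμ : ∀ i, 0 < μ i)
    {p : ℝ} (hp : 2 ≤ p) {q : ℕ → X → ℝ} {ε : ℝ} (hε : 0 ≤ ε)
    (hq : ∀ k, wNorm μ p (q (k + 1) - q k) ≤ ε * (wNorm μ p (q k) + 1)) (k : ℕ) {m : ℕ}
    (hm : ε * m ≤ 1 / 4) :
    wNorm μ p (q (k + m) - q k) ≤ 2 * (ε * m) * (wNorm μ p (q k) + 1) := by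
  have hN := wNorm_nonneg hμ p (q k)
  induction m with
  | zero => simp [wNorm_zero μ hp]
  | succ m ih =>
    push_cast at hm ⊢
    have hm' : ε * m ≤ 1 / 4 := by linarith
    have h1 := ih hm'
    have h2 := hq (k + m)
    have h3 := wNorm_add_le hμ hp (q (k + m + 1) - q (k + m)) (q (k + m) - q k)
    have h4 := wNorm_add_le hμ hp (q (k + m) - q k) (q k)
    rw [sub_add_sub_cancel] at h3
    rw [sub_add_cancel] at h4
    -- The quarter bound on `ε * m` keeps norm plus one from more than doubling, so each further
    -- increment costs at most twice the first.
    have h5 : wNorm μ p (q (k + m)) + 1 ≤ 2 * (wNorm μ p (q k) + 1) := by nlinarith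
    have h6 := mul_le_mul_of_nonneg_left h5 hε
    rw [← Nat.add_assoc]
    linarith

/-- Bias of the noise at a delayed iterate. -/
theorem IsTrajectory.integral_noise_le [DecidableEq S] [DecidableEq A] [Nonempty S]
    {M : MDP S A} {πb : Policy S A} {Ω : Type*} [MeasurableSpace Ω] {Pr : Measure Ω}
    [IsProbabilityMeasure Pr] {Z : ℕ → Ω → S × A} (hZ : IsTrajectory M πb Pr Z)
    (hirr : IrreducibleChain (stateChain M πb)) (haper : AperiodicChain (stateChain M πb))
    (n : ℕ) (c ρ : S × A → ℝ) {δ : ℝ} (hδ : 0 < δ) {m : ℕ}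
    {u q : (ℕ → S × A) → S × A → ℝ} (hu : DependsOn u (Set.Iic m)) (hq : DependsOn q (Set.Iic m))
    {B : (ℕ → S × A) → ℝ} {m' : ℕ} (hB : DependsOn B (Set.Iic m'))
    (h : ∀ z x, |u z x * (traceSum M πb n c).mulVec (tdMean M πb ρ (q z)) x| ≤ B z) :
    ∫ ω, ∑ x, u (fun i => Z i ω) x *
        (incVec M n c ρ (q fun i => Z i ω) (fun i => Z i ω)
          (m + (mixingTime (stateChain M πb) δ + 1)) x -
          meanInc M πb n c ρ (q fun i => Z i ω) x) ∂Pr ≤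
      2 * δ * ∫ ω, B (fun i => Z i ω) ∂Pr := by
  set t := mixingTime (stateChain M πb) δ
  set k := m + (t + 1) with hk
  have hmk : ∀ {a : ℕ} {z z' : ℕ → S × A}, m ≤ a → (∀ j ∈ Set.Iic a, z j = z' j) →
      ∀ j ∈ Set.Iic m, z j = z' j := fun ha h j hj =>
    h j (Set.mem_Iic.2 ((Set.mem_Iic.1 hj).trans ha))
  have d1 : DependsOn (fun z : ℕ → S × A => u z (z k) * tdInc M n c ρ (q z) z k)
      (Set.Iic (k + n)) := fun z z' h => by
    simp only [hu (hmk (by omega) h), hq (hmk (by omega) h), h k (Set.mem_Iic.2 (by omega)),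
      tdInc_congr c ρ (q z') fun j hj => h j (Set.mem_Iic.2 hj)]
  have d2 : DependsOn (fun z : ℕ → S × A => ∑ x, u z x * meanInc M πb n c ρ (q z) x)
      (Set.Iic m) := fun z z' h => by simp only [hu h, hq h]
  have d3 : DependsOn (fun z : ℕ → S × A => (ratioKernel M πb (fun _ => 1) ^ (t + 1)).mulVec
      (fun x => u z x * (traceSum M πb n c).mulVec (tdMean M πb ρ (q z)) x) (z m))
      (Set.Iic m) := fun z z' h => by simp only [hu h, hq h, h m (Set.mem_Iic.2 le_rfl)]
  -- The actual increment is supported at the visited pair `z k`, so its pairing with `u` is a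
  -- single product.
  have e1 : ∀ z : ℕ → S × A, ∑ x, u z x *
      (incVec M n c ρ (q z) z k x - meanInc M πb n c ρ (q z) x) =
      u z (z k) * tdInc M n c ρ (q z) z k - ∑ x, u z x * meanInc M πb n c ρ (q z) x := by
    intro z
    simp only [mul_sub, Finset.sum_sub_distrib]
    congr 1
    simp [incVec]
  simp only [e1]
  have i1 := hZ.integrable d1
  have i2 := hZ.integrable d2
  have i3 := hZ.integrable d3
  simp only at i1 i2 i3
  rw [integral_sub i1 i2, hk, hZ.integral_tdInc n c ρ (t + 1) hu hq, ← integral_sub i3 i2,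
    ← integral_const_mul]
  refine integral_mono (i3.sub i2) ((hZ.integrable hB).const_mul _) fun ω => ?_
  set z : ℕ → S × A := fun i => Z i ω
  have hB0 : 0 ≤ B z := (abs_nonneg _).trans (h z (Z m ω))
  -- What remains is a bounded function integrated against the law after `t + 1` steps minus the
  -- stationary law, whose `ℓ_1` distance is at most `2δ`. The bound `B` may look beyond time `m`,
  -- since it is used pathwise.
  have e2 : (ratioKernel M πb (fun _ => 1) ^ (t + 1)).mulVec
      (fun x => u z x * (traceSum M πb n c).mulVec (tdMean M πb ρ (q z)) x) (Z m ω) -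
      ∑ x, u z x * meanInc M πb n c ρ (q z) x =
      ∑ x, ((ratioKernel M πb (fun _ => 1) ^ (t + 1)) (Z m ω) x - stationarySA M πb x) *
        (u z x * (traceSum M πb n c).mulVec (tdMean M πb ρ (q z)) x) := by
    simp only [Matrix.mulVec, dotProduct, meanInc, sub_mul, Finset.sum_sub_distrib]
    congr 1
    exact Finset.sum_congr rfl fun x _ => by ring
  show (ratioKernel M πb (fun _ => 1) ^ (t + 1)).mulVec
      (fun x => u z x * (traceSum M πb n c).mulVec (tdMean M πb ρ (q z)) x) (Z m ω) -
      ∑ x, u z x * meanInc M πb n c ρ (q z) x ≤ 2 * δ * B z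
  rw [e2]
  calc _ ≤ ∑ x, |(ratioKernel M πb (fun _ => 1) ^ (t + 1)) (Z m ω) x - stationarySA M πb x| *
        B z := by
        refine Finset.sum_le_sum fun x _ => (le_abs_self _).trans ?_
        rw [abs_mul]
        exact mul_le_mul_of_nonneg_left (h z x) (abs_nonneg _)
    _ ≤ _ := by
        rw [← Finset.sum_mul]
        exact mul_le_mul_of_nonneg_right
          (sum_abs_ratioKernel_pow_sub_le M πb hirr haper hδ (Z m ω)) hB0

end Iteration

/-! ### Mean square drift and the initial window. -/

section Convergence

open MeasureTheory

variable {S A : Type*} [Fintype S] [Fintype A] [DecidableEq S] [DecidableEq A]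

theorem wNorm_tdIterate_succ_sub_le [Nonempty S] [Nonempty A] {M : MDP S A} {n : ℕ} (hn : 1 ≤ n)
    {c ρ μ : S × A → ℝ} (hc : ∀ x, 0 ≤ c x) (hρ : ∀ x, 0 ≤ ρ x) (hμ : ∀ x, 0 < μ x)
    (hμ1 : ∑ x, μ x = 1) {p : ℝ} (hp : 2 ≤ p) {α : ℝ} (hα : 0 ≤ α) (Q₀ : S × A → ℝ)
    (z : ℕ → S × A) (k : ℕ) :
    wNorm μ p (tdIterate M n c ρ α Q₀ z (k + 1) - tdIterate M n c ρ α Q₀ z k) ≤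
      α * lipConst M n c ρ μ p * (wNorm μ p (tdIterate M n c ρ α Q₀ z k) + 1) := by
  rw [tdIterate_succ, add_sub_cancel_left, wNorm_smul hμ hp hα, mul_assoc]
  exact mul_le_mul_of_nonneg_left (wNorm_incVec_le hn hc hρ hμ hμ1 hp _ z k) hα

theorem dependsOn_tdIterate {S A : Type*} [Fintype S] [DecidableEq S] [DecidableEq A]
    (M : MDP S A) (n : ℕ) (c ρ : S × A → ℝ) (α : ℝ) (Q₀ : S × A → ℝ)
    {k m : ℕ} (h : k + n ≤ m + 1) :
    DependsOn (fun z => tdIterate M n c ρ α Q₀ z k) (Set.Iic m) := fun _ _ hz =>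
  tdIterate_congr M n c ρ α Q₀ fun i hi => hz i (Set.mem_Iic.2 (by omega))

/-- Mean square drift of the iterates. -/
theorem IsTrajectory.integral_wNorm_sq_succ_le [Nonempty S] [Nonempty A]
    {M : MDP S A} {πb : Policy S A} {Ω : Type*} [MeasurableSpace Ω] {Pr : Measure Ω}
    [IsProbabilityMeasure Pr] {Z : ℕ → Ω → S × A} (hZ : IsTrajectory M πb Pr Z)
    (hirr : IrreducibleChain (stateChain M πb)) (haper : AperiodicChain (stateChain M πb))
    {n : ℕ} (hn : 1 ≤ n) {c ρ μ : S × A → ℝ} (hc : ∀ x, 0 ≤ c x) (hρ : ∀ x, 0 ≤ ρ x)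
    (hμ : ∀ x, 0 < μ x) (hμ1 : ∑ x, μ x = 1) {p : ℝ} (hp : 2 ≤ p) {α : ℝ} (hα : 0 < α)
    (Q₀ Q' : S × A → ℝ) {κ : ℝ}
    (hκ : ∀ q, ∑ x, wGrad μ p (q - Q') x * meanInc M πb n c ρ q x ≤ -κ * wNorm μ p (q - Q') ^ 2)
    (hsmall : lipConst M n c ρ μ p * (α * delay M πb n α) ≤ 1 / 100)
    {k : ℕ} (hk : delay M πb n α ≤ k) :
    ∫ ω, wNorm μ p (tdIterate M n c ρ α Q₀ (fun i => Z i ω) (k + 1) - Q') ^ 2 ∂Pr ≤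
      (1 - 2 * α * κ) *
        (∫ ω, wNorm μ p (tdIterate M n c ρ α Q₀ (fun i => Z i ω) k - Q') ^ 2 ∂Pr) +
      2 * α * ((21 * p + 20) * (lipConst M n c ρ μ p ^ 2 * (α * delay M πb n α))) *
        (2 * (∫ ω, wNorm μ p (tdIterate M n c ρ α Q₀ (fun i => Z i ω) k - Q') ^ 2 ∂Pr) +
          2 * (wNorm μ p Q' + 1) ^ 2) := by
  have hL := one_le_lipConst (M := M) hn hc hρ hμ hμ1 hp
  set L := lipConst M n c ρ μ p
  set y := α * delay M πb n α with hy
  set Q : (ℕ → S × A) → ℕ → S × A → ℝ := tdIterate M n c ρ α Q₀ with hQ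
  set t := mixingTime (stateChain M πb) α with ht
  have hdelay : delay M πb n α = t + n + 1 := rfl
  rw [hdelay] at hk hy
  -- The state-action chain mixes in the `t + 1` steps from `m` to `k`, and `k₀ = m + 1 - n` is the
  -- last iterate determined by the path up to `m`. The lag `k - k₀` is `t + n`, within the delay.
  obtain ⟨m, rfl⟩ : ∃ m, k = m + (t + 1) := ⟨k - (t + 1), by omega⟩
  obtain ⟨k₀, hk₀⟩ : ∃ k₀, k₀ + n = m + 1 := ⟨m + 1 - n, by omega⟩
  set k := m + (t + 1) with hkdef
  have hkk : k = k₀ + (t + n) := by omega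
  have hαy : α ≤ y := by
    rw [hy]
    refine le_mul_of_one_le_right hα.le ?_
    exact_mod_cast Nat.le_add_left 1 (t + n)
  set x := α * L * ((t + n : ℕ) : ℝ) with hx
  have hx0 : 0 ≤ x := by positivity
  have hxy : x ≤ L * y := by
    rw [hx, hy, mul_comm α L, mul_assoc]
    refine mul_le_mul_of_nonneg_left (mul_le_mul_of_nonneg_left ?_ hα.le) (by linarith)
    exact_mod_cast Nat.le_succ (t + n)
  have hN := wNorm_nonneg hμ p
  -- This one quantity dominates, up to constants, the error and the iterate at both times `k` and
  -- `k₀`, so all error terms can be expressed through its second moment.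
  set b : (ℕ → S × A) → ℝ := fun z => wNorm μ p (Q z k - Q') + wNorm μ p Q' + 1 with hb
  have hb0 : ∀ z, 0 ≤ b z := fun z => by
    have := hN (Q z k - Q'); have := hN Q'; simp only [hb]; linarith
  have hab : ∀ z, wNorm μ p (Q z k) + 1 ≤ b z := fun z => by
    have := wNorm_add_le hμ hp (Q z k - Q') Q'
    rw [sub_add_cancel] at this
    simp only [hb]
    linarith
  have hwin : ∀ z, wNorm μ p (Q z k - Q z k₀) ≤ 2 * x * (wNorm μ p (Q z k₀) + 1) := fun z => by
    rw [hkk]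
    exact wNorm_sub_le_of_increments hμ hp (q := Q z) (ε := α * L) (by positivity)
      (wNorm_tdIterate_succ_sub_le hn hc hρ hμ hμ1 hp hα.le Q₀ z) k₀ (by linarith)
  have hback : ∀ z, wNorm μ p (Q z k₀) + 1 ≤ 3 / 2 * (wNorm μ p (Q z k) + 1) := fun z => by
    have h1 := wNorm_sub_le hμ hp (Q z k) (Q z k - Q z k₀)
    rw [sub_sub_cancel] at h1
    have h2 := hwin z
    have h3 : x * (wNorm μ p (Q z k₀) + 1) ≤ 1 / 100 * (wNorm μ p (Q z k₀) + 1) :=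
      mul_le_mul_of_nonneg_right (hxy.trans hsmall) (by linarith [hN (Q z k₀)])
    linarith [hN (Q z k₀)]
  have hdiff : ∀ z, wNorm μ p (Q z k - Q z k₀) ≤ 3 * x * (wNorm μ p (Q z k) + 1) := fun z => by
    have := mul_le_mul_of_nonneg_left (hback z) (show 0 ≤ 2 * x by positivity)
    linarith [hwin z]
  have hu : ∀ z, wNorm μ p (Q z k₀ - Q') ≤ 2 * b z := fun z => by
    have h1 := wNorm_sub_le hμ hp (Q z k - Q') (Q z k - Q z k₀)
    rw [sub_sub_sub_cancel_left] at h1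
    have h2 : x * (wNorm μ p (Q z k) + 1) ≤ 1 / 100 * b z :=
      mul_le_mul (hxy.trans hsmall) (hab z) (by linarith [hN (Q z k)]) (by norm_num)
    have h3 : wNorm μ p (Q z k - Q') ≤ b z := by simp only [hb]; linarith [hN Q']
    linarith [hdiff z, hb0 z]
  set D : (ℕ → S × A) → ℝ := fun z => ∑ x, wGrad μ p (Q z k₀ - Q') x *
    (incVec M n c ρ (Q z k₀) z k x - meanInc M πb n c ρ (Q z k₀) x) with hD
  have hpath : ∀ z, wNorm μ p (Q z (k + 1) - Q') ^ 2 ≤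
      (1 - 2 * α * κ) * wNorm μ p (Q z k - Q') ^ 2 +
      2 * α * ((21 * p + 12) * (L ^ 2 * y)) * b z ^ 2 + 2 * α * D z := fun z => by
    have hvu : Q z k - Q' - (Q z k₀ - Q') = Q z k - Q z k₀ := sub_sub_sub_cancel_right _ _ _
    have h1 := wNorm_sq_drift hμ hp (v := Q z k - Q') (u := Q z k₀ - Q')
      (h := incVec M n c ρ (Q z k) z k) (h₀ := incVec M n c ρ (Q z k₀) z k)
      (g := meanInc M πb n c ρ (Q z k)) (g₀ := meanInc M πb n c ρ (Q z k₀))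
      (L := L) (x := x) (y := y) (α := α) (a := wNorm μ p (Q z k) + 1) (b := b z) (κ := κ)
      (hκ _) (by rw [hvu]; exact hdiff z) (hu z) (wNorm_incVec_le hn hc hρ hμ hμ1 hp _ z k)
      (wNorm_meanInc_le πb hn hc hρ hμ hμ1 hp _)
      (by rw [hvu]; exact wNorm_incVec_sub_le hc hρ hμ hμ1 hp _ _ z k)
      (by rw [hvu]; exact wNorm_meanInc_sub_le πb hc hρ hμ hμ1 hp _ _)
      (by linarith [hN (Q z k)]) (hab z) hL hxy hα hαy
    have h2 : Q z (k + 1) - Q' = Q z k - Q' + α • incVec M n c ρ (Q z k) z k := by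
      simp only [hQ]
      rw [tdIterate_succ]
      abel
    rw [h2]
    linarith
  have dQ : ∀ j, DependsOn (fun z => Q z j) (Set.Iic (j + n)) := fun j =>
    dependsOn_tdIterate M n c ρ α Q₀ (by omega)
  have dQ0 : DependsOn (fun z => Q z k₀) (Set.Iic m) :=
    dependsOn_tdIterate M n c ρ α Q₀ (by omega)
  have dv : ∀ j, DependsOn (fun z => wNorm μ p (Q z j - Q') ^ 2) (Set.Iic (j + n)) :=
    fun j z z' h => by simp only [dQ j h]
  have db : DependsOn (fun z => b z ^ 2) (Set.Iic (k + n)) := fun z z' h => by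
    simp only [hb, dQ k h]
  have dB : DependsOn (fun z => 4 * L * b z ^ 2) (Set.Iic (k + n)) := fun z z' h => by
    simp only [db h]
  have dD : DependsOn D (Set.Iic (k + n)) := fun z z' h => by
    have h1 := dQ0 fun i hi => h i (Set.mem_Iic.2 ((Set.mem_Iic.1 hi).trans (by omega)))
    have h2 : tdInc M n c ρ (Q z' k₀) z k = tdInc M n c ρ (Q z' k₀) z' k :=
      tdInc_congr c ρ _ fun j hj => h j (Set.mem_Iic.2 hj)
    simp only at h1
    simp only [hD, h1, incVec, h2, h k (Set.mem_Iic.2 (by omega))]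
  have du : DependsOn (fun z => wGrad μ p (Q z k₀ - Q')) (Set.Iic m) := fun z z' h => by
    simp only [dQ0 h]
  have hnoise : ∫ ω, D (fun i => Z i ω) ∂Pr ≤
      2 * α * ∫ ω, 4 * L * b (fun i => Z i ω) ^ 2 ∂Pr := by
    refine hZ.integral_noise_le hirr haper n c ρ hα du dQ0 dB fun z x => ?_
    rw [abs_mul]
    have h1 := (abs_wGrad_le hμ hμ1 hp (Q z k₀ - Q') x).trans (hu z)
    have h2 := abs_traceSum_tdMean_le (M := M) πb hn hc hρ hμ hμ1 hp (Q z k₀) x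
    have h3 : wNorm μ p (Q z k₀) + 1 ≤ 2 * b z := by linarith [hback z, hab z, hN (Q z k)]
    calc _ ≤ (2 * b z) * (L * (2 * b z)) := mul_le_mul h1
          (h2.trans (mul_le_mul_of_nonneg_left h3 (by linarith))) (abs_nonneg _)
          (by linarith [hb0 z])
      _ = _ := by ring
  have iv := hZ.integrable (dv k)
  have iv' := hZ.integrable (dv (k + 1))
  have ib := hZ.integrable db
  have iD := hZ.integrable dD
  set e := ∫ ω, wNorm μ p (Q (fun i => Z i ω) k - Q') ^ 2 ∂Pr
  set E := ∫ ω, b (fun i => Z i ω) ^ 2 ∂Pr with hE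
  have hEle : E ≤ 2 * e + 2 * (wNorm μ p Q' + 1) ^ 2 := by
    have h1 : E ≤ ∫ ω, (2 * wNorm μ p (Q (fun i => Z i ω) k - Q') ^ 2 +
        2 * (wNorm μ p Q' + 1) ^ 2) ∂Pr := by
      refine integral_mono ib ((iv.const_mul 2).add (integrable_const _)) fun ω => ?_
      simp only [hb]
      nlinarith [sq_nonneg (wNorm μ p (Q (fun i => Z i ω) k - Q') - (wNorm μ p Q' + 1))]
    rw [integral_add (iv.const_mul 2) (integrable_const _), integral_const_mul] at h1
    simpa using h1
  have hmain : ∫ ω, wNorm μ p (Q (fun i => Z i ω) (k + 1) - Q') ^ 2 ∂Pr ≤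
      (1 - 2 * α * κ) * e + 2 * α * ((21 * p + 12) * (L ^ 2 * y)) * E +
        2 * α * ∫ ω, D (fun i => Z i ω) ∂Pr := by
    refine (integral_mono iv' (((iv.const_mul (1 - 2 * α * κ)).add
      (ib.const_mul (2 * α * ((21 * p + 12) * (L ^ 2 * y))))).add (iD.const_mul (2 * α)))
      fun ω => hpath _).trans (le_of_eq ?_)
    rw [integral_add' ((iv.const_mul _).add (ib.const_mul _)) (iD.const_mul _),
      integral_add' (iv.const_mul _) (ib.const_mul _), integral_const_mul, integral_const_mul,
      integral_const_mul]
  rw [integral_const_mul, ← hE] at hnoise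
  have hE0 : 0 ≤ E := integral_nonneg fun ω => sq_nonneg _
  -- Using `α ≤ y` and `L ≥ 1`, the noise bias takes the form of the other error terms; its `8`
  -- raises `21p + 12` to `21p + 20`.
  have h1 : 2 * α * (4 * L * E) ≤ 8 * (L ^ 2 * y) * E := by
    have h2 : α * L ≤ y * L ^ 2 := mul_le_mul hαy (by nlinarith) (by linarith) (hα.le.trans hαy)
    nlinarith [mul_le_mul_of_nonneg_right h2 hE0]
  have h3 : 2 * α * ∫ ω, D (fun i => Z i ω) ∂Pr ≤ 2 * α * (8 * (L ^ 2 * y) * E) :=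
    mul_le_mul_of_nonneg_left (hnoise.trans h1) (by positivity)
  have hy0 : 0 ≤ y := hα.le.trans hαy
  have h4 : 2 * α * ((21 * p + 20) * (L ^ 2 * y)) * E ≤
      2 * α * ((21 * p + 20) * (L ^ 2 * y)) * (2 * e + 2 * (wNorm μ p Q' + 1) ^ 2) :=
    mul_le_mul_of_nonneg_left hEle (by positivity)
  linarith

/-- For a short time the iterate stays within `‖Q₀‖ + 1` of `Q₀` on every path. Taken at the end of
the delay, this starts the recursion. -/
theorem integral_wNorm_sq_le_of_close [Nonempty S] [Nonempty A]
    {M : MDP S A} {πb : Policy S A} {Ω : Type*} [MeasurableSpace Ω] {Pr : Measure Ω}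
    [IsProbabilityMeasure Pr] {Z : ℕ → Ω → S × A} (hZ : IsTrajectory M πb Pr Z)
    {n : ℕ} (hn : 1 ≤ n) {c ρ μ : S × A → ℝ} (hc : ∀ x, 0 ≤ c x) (hρ : ∀ x, 0 ≤ ρ x)
    (hμ : ∀ x, 0 < μ x) (hμ1 : ∑ x, μ x = 1) {p : ℝ} (hp : 2 ≤ p) {α : ℝ} (hα : 0 < α)
    (Q₀ Q' : S × A → ℝ) {k : ℕ} (hsmall : lipConst M n c ρ μ p * (α * k) ≤ 1 / 100) :
    ∫ ω, wNorm μ p (tdIterate M n c ρ α Q₀ (fun i => Z i ω) k - Q') ^ 2 ∂Pr ≤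
      (wNorm μ p (Q₀ - Q') + wNorm μ p Q₀ + 1) ^ 2 := by
  have hN := wNorm_nonneg hμ p
  have hL := one_le_lipConst (M := M) hn hc hρ hμ hμ1 hp
  have h1 : ∀ z, wNorm μ p (tdIterate M n c ρ α Q₀ z k - Q') ≤
      wNorm μ p (Q₀ - Q') + wNorm μ p Q₀ + 1 := fun z => by
    have h2 := wNorm_sub_le_of_increments hμ hp (q := tdIterate M n c ρ α Q₀ z)
      (ε := α * lipConst M n c ρ μ p) (by positivity)
      (wNorm_tdIterate_succ_sub_le hn hc hρ hμ hμ1 hp hα.le Q₀ z) 0 (m := k) (by linarith)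
    rw [zero_add] at h2
    have h3 : tdIterate M n c ρ α Q₀ z 0 = Q₀ := rfl
    rw [h3] at h2
    have h4 := wNorm_add_le hμ hp (tdIterate M n c ρ α Q₀ z k - Q₀) (Q₀ - Q')
    rw [sub_add_sub_cancel] at h4
    have h5 : 2 * (α * lipConst M n c ρ μ p * k) * (wNorm μ p Q₀ + 1) ≤
        1 * (wNorm μ p Q₀ + 1) :=
      mul_le_mul_of_nonneg_right (by linarith) (by linarith [hN Q₀])
    linarith
  have dv : DependsOn (fun z => wNorm μ p (tdIterate M n c ρ α Q₀ z k - Q') ^ 2)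
      (Set.Iic (k + n)) := fun z z' h => by
    simp only [dependsOn_tdIterate M n c ρ α Q₀ (Nat.le_succ _) h]
  refine (integral_mono (hZ.integrable dv) (integrable_const
    ((wNorm μ p (Q₀ - Q') + wNorm μ p Q₀ + 1) ^ 2))
    fun ω => pow_le_pow_left₀ (hN _) (h1 _) 2).trans ?_
  simp

end Convergence

/-! ### Solving the scalar recursion and assembling the bound. -/

theorem geometric_recursion_le {e : ℕ → ℝ} {w s C : ℝ} (hw : w ≤ 1) (hs0 : 0 ≤ s) (hs : 1 - w ≤ s)
    (he0 : 0 ≤ e 0) (hC : 0 ≤ C) (he : ∀ k, e (k + 1) ≤ (1 - w) * e k + w * C) (k : ℕ) :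
    e k ≤ e 0 * s ^ k + C := by
  induction k with
  | zero => simpa using hC
  | succ k ih =>
    have h1 := mul_le_mul_of_nonneg_left ih (sub_nonneg.2 hw)
    have h2 := mul_le_mul_of_nonneg_right hs (mul_nonneg he0 (pow_nonneg hs0 k))
    rw [pow_succ]
    linarith [he k]

/-- Since `p ≥ 2`, the noise coefficient `4(21p + 20)` is at most `124p`, and the stepsize condition
makes the resulting multiple of `e j` at most `θwα`. Out of the drift `(1 + θ)wα` there remains
`wα`, with fixed point `124 (X / w) W`. Both the stated rate `1 - θwα` and the constant `228` leave
slack. -/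
theorem mean_square_recursion_le {e : ℕ → ℝ} {w θ α p L y m E W W' : ℝ} (he : ∀ j, 0 ≤ e j)
    (hW : 0 ≤ W) (hWW : W ≤ W') (hp : 2 ≤ p) (hα : 0 < α) (hw : 0 < w)
    (hwα : w * α ≤ 1) (hθ₁ : θ ≤ 1) (hm : 0 < m) (hy : 0 ≤ L ^ 2 * y)
    (hstep : 2052 * p * (L ^ 2 * y) ≤ θ * w) (he0 : e 0 ≤ E)
    (hrec : ∀ j, e (j + 1) ≤ (1 - 2 * α * ((1 + θ) / 2 * w)) * e j +
      2 * α * ((21 * p + 20) * (L ^ 2 * y)) * (2 * e j + 2 * W)) (j : ℕ) :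
    e j ≤ E * (1 - θ * w * α) ^ j + 228 * W' * (p * (L ^ 2 * m) / (m * w)) * y := by
  have hp0 : 0 < p := by linarith
  set X := p * (L ^ 2 * y) with hX
  have hX0 : 0 ≤ X := mul_nonneg hp0.le hy
  have hθwα : θ * w * α ≤ w * α :=
    mul_le_mul_of_nonneg_right (mul_le_of_le_one_left hw.le hθ₁) hα.le
  have hC : 0 ≤ 124 * (X / w) * W :=
    mul_nonneg (mul_nonneg (by norm_num) (div_nonneg hX0 hw.le)) hW
  have hrec' : ∀ j, e (j + 1) ≤ (1 - w * α) * e j + w * α * (124 * (X / w) * W) := by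
    intro j
    have h2 : w * α * (124 * (X / w) * W) = α * (124 * X * W) := by
      field_simp
    have h3 : 2 * α * ((21 * p + 20) * (L ^ 2 * y)) * (2 * e j + 2 * W) ≤
        α * (124 * X) * (e j + W) := by
      have h4 : 0 ≤ α * (L ^ 2 * y) * (e j + W) :=
        mul_nonneg (mul_nonneg hα.le hy) (add_nonneg (he j) hW)
      have h5 := mul_le_mul_of_nonneg_right hp h4
      calc _ = 84 * (p * (α * (L ^ 2 * y) * (e j + W))) +
            40 * (2 * (α * (L ^ 2 * y) * (e j + W))) := by ring
        _ ≤ 84 * (p * (α * (L ^ 2 * y) * (e j + W))) +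
            40 * (p * (α * (L ^ 2 * y) * (e j + W))) := by linarith
        _ = _ := by rw [hX]; ring
    have h5 : α * (124 * X) * e j ≤ α * (θ * w) * e j :=
      mul_le_mul_of_nonneg_right (mul_le_mul_of_nonneg_left (by linarith) hα.le) (he j)
    have h6 := hrec j
    rw [h2]
    linarith
  have hgeo := geometric_recursion_le (s := 1 - θ * w * α) hwα (by linarith) (by linarith)
    (he 0) hC hrec' j
  refine hgeo.trans (add_le_add
    (mul_le_mul_of_nonneg_right he0 (pow_nonneg (by linarith) _)) ?_)
  have h6 : 228 * W' * (p * (L ^ 2 * m) / (m * w)) * y = 228 * (X / w) * W' := by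
    rw [hX]
    field_simp
  rw [h6]
  have h7 : 0 ≤ X / w := div_nonneg hX0 hw.le
  exact mul_le_mul (by linarith) hWW hW (by linarith)

/-- Mean square error bound of the algorithm in a norm whose weights are almost invariant under
the Bellman matrix. -/
theorem IsTrajectory.integral_wNorm_sq_le {S A : Type*} [Fintype S] [Fintype A] [DecidableEq S]
    [DecidableEq A] [Nonempty S] [Nonempty A] {M : MDP S A} {πb : Policy S A}
    {Ω : Type*} [MeasurableSpace Ω] {Pr : MeasureTheory.Measure Ω}
    [MeasureTheory.IsProbabilityMeasure Pr] {Z : ℕ → Ω → S × A} (hZ : IsTrajectory M πb Pr Z)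
    (hπb : ∀ s a, 0 < πb.prob s a)
    (hirr : IrreducibleChain (stateChain M πb)) (haper : AperiodicChain (stateChain M πb))
    {n : ℕ} (hn : 1 ≤ n) {c ρ μ : S × A → ℝ} (hc : ∀ x, 0 ≤ c x) (hcρ : ∀ x, c x ≤ ρ x)
    (hD : (⨆ s, diagD πb ρ s) < 1 / M.disc) {θ : ℝ} (hθ₀ : 0 < θ) (hθ₁ : θ < 1)
    (hμ : ∀ x, 0 < μ x) (hμ1 : ∑ x, μ x = 1)
    (hμG : ∀ y, ∑ x, μ x * bellmanMatrix M πb n c ρ x y ≤ (1 - θ * omega M πb n c ρ) * μ y)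
    {p : ℝ} (hp : 2 ≤ p) {α : ℝ} (hα : 0 < α)
    (hstep : α * delay M πb n α ≤ θ * (⨅ x, μ x) ^ (2 / p) * omega M πb n c ρ /
      (2052 * p * varFactor M n c ρ))
    (Q₀ : S × A → ℝ) {k : ℕ} (hk : delay M πb n α ≤ k) :
    ∫ ω, wNorm μ p (tdIterate M n c ρ α Q₀ (fun i => Z i ω) k - limitQ M πb ρ) ^ 2 ∂Pr ≤
      (wNorm μ p (Q₀ - limitQ M πb ρ) + wNorm μ p Q₀ + 1) ^ 2 *
        (1 - θ * omega M πb n c ρ * α) ^ (k - delay M πb n α) +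
      228 * (3 * wNorm μ p (limitQ M πb ρ) + 1) ^ 2 *
        (p * varFactor M n c ρ / ((⨅ x, μ x) ^ (2 / p) * omega M πb n c ρ)) *
        (α * delay M πb n α) := by
  have hρ : ∀ x, 0 ≤ ρ x := fun x => (hc x).trans (hcρ x)
  have hω := omega_pos M πb hπb hirr hn hc hD
  have hG := bellmanMatrix_nonneg M πb hn hc hcρ
  have hrow := bellmanMatrix_row_sum_le (n := n) (c := c) M πb hc hD
  have hω1 : omega M πb n c ρ ≤ 1 := by
    obtain ⟨x⟩ : Nonempty (S × A) := inferInstance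
    have := (Finset.sum_nonneg fun y _ => hG x y).trans (hrow x)
    linarith
  have hL := one_le_lipConst (M := M) hn hc hρ hμ hμ1 hp
  have hLsq := lipConst_sq (M := M) (n := n) (c := c) (ρ := ρ) (p := p) hμ
  have hm2 : 0 < (⨅ x, μ x) ^ (2 / p) := Real.rpow_pos_of_pos (iInf_weight_pos hμ) _
  have hκ : ∀ q, ∑ x, wGrad μ p (q - limitQ M πb ρ) x * meanInc M πb n c ρ q x ≤
      -((1 + θ) / 2 * omega M πb n c ρ) * wNorm μ p (q - limitQ M πb ρ) ^ 2 := by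
    intro q
    have h1 := wGrad_pair_mulVec_le hμ hp hG hω.le hθ₁.le hrow hμG (q - limitQ M πb ρ)
    have h2 := wGrad_pair_self hμ hp (q - limitQ M πb ρ)
    have h3 : ∑ x, wGrad μ p (q - limitQ M πb ρ) x * meanInc M πb n c ρ q x =
        ∑ x, wGrad μ p (q - limitQ M πb ρ) x *
          (bellmanMatrix M πb n c ρ).mulVec (q - limitQ M πb ρ) x -
        ∑ x, wGrad μ p (q - limitQ M πb ρ) x * (q - limitQ M πb ρ) x := by
      rw [← Finset.sum_sub_distrib, meanInc_eq M πb n c hρ hD]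
      exact Finset.sum_congr rfl fun x _ => mul_sub _ _ _
    linarith
  set L := lipConst M n c ρ μ p
  set w := omega M πb n c ρ
  set τ := delay M πb n α with hτ
  set m2 := (⨅ x, μ x) ^ (2 / p)
  -- In terms of `L` the weight factor cancels, and the stepsize condition reads `2052 p L² y ≤ θ
  -- w`; with `p ≥ 2`, `L ≥ 1` and `θ w ≤ 1` it also implies the smallness needed for the window
  -- estimates.
  have hVF : varFactor M n c ρ = L ^ 2 * m2 := by rw [hLsq]; field_simp
  rw [hVF] at hstep ⊢
  have hτ1 : (1 : ℝ) ≤ τ := by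
    have : 1 ≤ τ := Nat.le_add_left 1 _
    exact_mod_cast this
  set y := α * (τ : ℝ) with hy
  have hαy : α ≤ y := le_mul_of_one_le_right hα.le hτ1
  have hy0 : 0 ≤ y := hα.le.trans hαy
  have hstep' : 2052 * p * (L ^ 2 * y) ≤ θ * w := by
    rw [le_div_iff₀ (by positivity)] at hstep
    refine le_of_mul_le_mul_right ?_ hm2
    linarith
  have hθw : θ * w ≤ 1 := by nlinarith
  have hL2y : 0 ≤ L ^ 2 * y := by positivity
  have hLy : L * y ≤ L ^ 2 * y := mul_le_mul_of_nonneg_right (by nlinarith) hy0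
  have hp2 := mul_le_mul_of_nonneg_right hp hL2y
  have hsmall : L * y ≤ 1 / 100 := by linarith
  have hα1 : α ≤ 1 := by nlinarith
  have hwα : w * α ≤ 1 := by nlinarith
  obtain ⟨j, rfl⟩ := Nat.exists_eq_add_of_le hk
  rw [Nat.add_sub_cancel_left]
  have hQ := wNorm_nonneg hμ p (limitQ M πb ρ)
  exact mean_square_recursion_le (e := fun j => ∫ ω, wNorm μ p
      (tdIterate M n c ρ α Q₀ (fun i => Z i ω) (τ + j) - limitQ M πb ρ) ^ 2 ∂Pr)
    (fun j => MeasureTheory.integral_nonneg fun ω => sq_nonneg _) (sq_nonneg _)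
    (pow_le_pow_left₀ (by linarith) (by linarith) 2) hp hα hω hwα hθ₁.le hm2 hL2y hstep'
    (integral_wNorm_sq_le_of_close hZ hn hc hρ hμ hμ1 hp hα Q₀ _ hsmall)
    (fun j => hZ.integral_wNorm_sq_succ_le hirr haper hn hc hρ hμ hμ1 hp hα Q₀
      (limitQ M πb ρ) hκ hsmall (k := τ + j) (Nat.le_add_right _ _)) j

end OffPolicyTD

theorem mainTheorem3 {S A : Type*} [Fintype S] [Fintype A] [DecidableEq S] [DecidableEq A]
    [Nonempty S] [Nonempty A]
    (M : OffPolicyTD.MDP S A) (πb : OffPolicyTD.Policy S A)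
    (hπb : ∀ s a, 0 < πb.prob s a)
    (hirr : OffPolicyTD.IrreducibleChain (OffPolicyTD.stateChain M πb))
    (haper : OffPolicyTD.AperiodicChain (OffPolicyTD.stateChain M πb))
    (n : ℕ) (hn : 1 ≤ n)
    (c ρ : S × A → ℝ) (hc : ∀ x, 0 ≤ c x) (hcρ : ∀ x, c x ≤ ρ x)
    (hD : (⨆ s, OffPolicyTD.diagD πb ρ s) < 1 / M.disc)
    (θ : ℝ) (hθ₀ : 0 < θ) (hθ₁ : θ < 1) :
    ∃ μ : S × A → ℝ,
      (∑ x, μ x = 1) ∧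
      (∀ x, 0 < μ x) ∧
      (OffPolicyTD.omega M πb n c ρ * (1 - θ) /
          ((1 - θ * OffPolicyTD.omega M πb n c ρ) * (Fintype.card S * Fintype.card A)) ≤
        ⨅ x, μ x) ∧
      ∀ (p : ℝ), 2 ≤ p → ∀ (α : ℝ), 0 < α →
        α * OffPolicyTD.delay M πb n α ≤
          θ * (⨅ x, μ x) ^ (2 / p) * OffPolicyTD.omega M πb n c ρ /
            (2052 * p * OffPolicyTD.varFactor M n c ρ) →
        ∀ (Q₀ : S × A → ℝ) (Ω : Type*) [MeasurableSpace Ω] (Pr : MeasureTheory.Measure Ω)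
          [MeasureTheory.IsProbabilityMeasure Pr] (Z : ℕ → Ω → S × A),
          OffPolicyTD.IsTrajectory M πb Pr Z →
          ∀ k : ℕ, OffPolicyTD.delay M πb n α ≤ k →
            ∫ w, OffPolicyTD.wNorm μ p
                (OffPolicyTD.tdIterate M n c ρ α Q₀ (fun i => Z i w) k -
                  OffPolicyTD.limitQ M πb ρ) ^ 2 ∂Pr ≤
              (OffPolicyTD.wNorm μ p (Q₀ - OffPolicyTD.limitQ M πb ρ) +
                  OffPolicyTD.wNorm μ p Q₀ + 1) ^ 2 *
                (1 - θ * OffPolicyTD.omega M πb n c ρ * α) ^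
                  (k - OffPolicyTD.delay M πb n α) +
              228 * (3 * OffPolicyTD.wNorm μ p (OffPolicyTD.limitQ M πb ρ) + 1) ^ 2 *
                (p * OffPolicyTD.varFactor M n c ρ /
                  ((⨅ x, μ x) ^ (2 / p) * OffPolicyTD.omega M πb n c ρ)) *
                (α * OffPolicyTD.delay M πb n α) := by
  obtain ⟨μ, hμ1, hμ, hμmin, hμG⟩ := OffPolicyTD.exists_weight
    (OffPolicyTD.bellmanMatrix_nonneg M πb hn hc hcρ)
    (OffPolicyTD.omega_pos M πb hπb hirr hn hc hD)
    (OffPolicyTD.bellmanMatrix_row_sum_le (n := n) (c := c) M πb hc hD) hθ₀ hθ₁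
  refine ⟨μ, hμ1, hμ, le_ciInf fun x => ?_, ?_⟩
  · simpa [Fintype.card_prod] using hμmin x
  · intro p hp α hα hstep Q₀ Ω _ Pr _ Z hZ k hk
    exact hZ.integral_wNorm_sq_le hπb hirr haper hn hc hcρ hD hθ₀ hθ₁ hμ hμ1 hμG hp hα hstep Q₀ hk
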